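/- Let $n\ge 1$ and let $p_0,\dots,p_{n-1}:\mathbb R\to\mathbb R$ be $\pi$-periodic functions such that, for every $j$, the derivatives $p_j^{(i)}$, $0\le i<j$, exist and are locally absolutely continuous on $\mathbb R$, and $\int_0^\pi |p_j^{(j)}(x)|\,dx<\infty$. Consider $$L=(-1)^n\frac{d^{2n}}{dx^{2n}}+\sum_{j=0}^{n-1}\frac{d^j}{dx^j}\,p_j(x)\,\frac{d^j}{dx^j}.$$ For $\mu\in\mathbb C$ let $u_1(\cdot,\mu),\dots,u_{2n}(\cdot,\mu)$ be the solutions on $\mathbb R$ of $Ly=\mu y$ (with $y,\dots,y^{(2n-1)}$ locally absolutely continuous and the equation holding almost everywhere) with $u_k^{(j)}(0,\mu)=\delta_{k-1,j}$ for $0\le j\le 2n-1$. Let $U(\mu)=\big(u_k^{(j-1)}(\pi,\mu)\big)_{k,j=1}^{2n}$ be the monodromy matrix, $\Delta(\mu,\rho)=\det(U(\mu)-\rho I)$, and $$\mathcal R(L)=\{(\mu,\rho)\in\mathbb C^2:\Delta(\mu,\rho)=0\},\qquad \mathcal Z(L)=\{\mu\in\mathbb C:\exists\,\rho\in\mathbb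 C,\ \Delta(\mu,\rho)=\Delta'_\rho(\mu,\rho)=0\}.$$ Then $\mathcal R(L)$ is a connected $2n$-sheeted Riemann surface over the $\mu$-plane, in the following sense: $\mathcal Z(L)$ has no accumulation point in $\mathbb C$; over every $\mu\notin\mathcal Z(L)$ there lie exactly $2n$ points of $\mathcal R(L)$; the unramified part $\{(\mu,\rho)\in\mathcal R(L):\mu\notin\mathcal Z(L)\}$ is path-connected (that is, the Riemann surface of $\rho(\mu)$ is connected also when self-crossings of $\mathcal R(L)$ in $\mathbb C^2$ are not used to pass from one sheet to another); and the set $\mathcal R(L)\subset\mathbb C^2$ is connected. -/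

import Mathlib

namespace PeriodicOperator

open MeasureTheory

/-- `f` is `m - 1` times continuously differentiable and `f, f', …, f^(m-1)` are locally absolutely
continuous on `ℝ`, so that `f^(m)` exists almost everywhere and is locally integrable. For `m = 0`
this is no condition. -/
def HasACDerivs {E : Type*} [NormedAddCommGroup E] [NormedSpace ℝ E] (m : ℕ) (f : ℝ → E) : Prop :=
  ∀ i < m, ContDiff ℝ i f ∧ ∀ a b : ℝ, AbsolutelyContinuousOnInterval (iteratedDeriv i f) a b

/-- The coefficients `p_0, …, p_{n-1}` of a periodic operator: real-valued, `π`-periodic, with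
`p_j^(j)` existing in the sense of absolutely continuous functions and
`∑_j ∫_0^π |p_j^(j)(x)| dx < ∞`. -/
structure IsCoefficients {n : ℕ} (p : Fin n → ℝ → ℝ) : Prop where
  periodic : ∀ j, Function.Periodic (p j) Real.pi
  hasACDerivs : ∀ j : Fin n, HasACDerivs (j : ℕ) (p j)
  integrable : ∀ j : Fin n, IntegrableOn (iteratedDeriv (j : ℕ) (p j)) (Set.Icc 0 Real.pi)

/-- The differential expression
`L y = (-1)^n y^(2n) + ∑_{j<n} (d/dx)^j (p_j(x) (d/dx)^j y)`. -/
noncomputable def L {n : ℕ} (p : Fin n → ℝ → ℝ) (y : ℝ → ℂ) (x : ℝ) : ℂ :=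
  (-1) ^ n * iteratedDeriv (2 * n) y x +
    ∑ j : Fin n, iteratedDeriv (j : ℕ) (fun t : ℝ => (p j t : ℂ) * iteratedDeriv (j : ℕ) y t) x

/-- `y` is a solution on `ℝ` of `L y - μ y = 0`, in the sense of Carathéodory. -/
def IsSolution {n : ℕ} (p : Fin n → ℝ → ℝ) (μ : ℂ) (y : ℝ → ℂ) : Prop :=
  HasACDerivs (2 * n) y ∧ ∀ᵐ x : ℝ, L p y x - μ * y x = 0

/-- The fundamental system `u_k(·, μ)` of solutions of `L y - μ y = 0` normalized by
`u_k^(j)(0, μ) = δ_{kj}`; the indices `k, j` run over `0, …, 2n - 1`. -/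
noncomputable def u {n : ℕ} (p : Fin n → ℝ → ℝ) (k : Fin (2 * n)) (μ : ℂ) : ℝ → ℂ :=
  Classical.epsilon fun y : ℝ → ℂ =>
    IsSolution p μ y ∧ ∀ j : Fin (2 * n), iteratedDeriv (j : ℕ) y 0 = if k = j then 1 else 0

/-- The monodromy matrix `U(μ) = (u_k^(j)(π, μ))_{k,j}`. -/
noncomputable def U {n : ℕ} (p : Fin n → ℝ → ℝ) (μ : ℂ) : Matrix (Fin (2 * n)) (Fin (2 * n)) ℂ :=
  Matrix.of fun k j => iteratedDeriv (j : ℕ) (u p k μ) Real.pi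

/-- `Δ(μ, ρ) = det (U(μ) - ρ I)`. -/
noncomputable def Δ {n : ℕ} (p : Fin n → ℝ → ℝ) (μ ρ : ℂ) : ℂ :=
  (U p μ - ρ • (1 : Matrix (Fin (2 * n)) (Fin (2 * n)) ℂ)).det

/-- The surface `𝓡(L) = {(μ, ρ) : Δ(μ, ρ) = 0}`. -/
def surface {n : ℕ} (p : Fin n → ℝ → ℝ) : Set (ℂ × ℂ) :=
  {z | Δ p z.1 z.2 = 0}

/-- The discriminant set: those `μ` over which `Δ(μ, ·)` has a multiple root. -/
def discriminantSet {n : ℕ} (p : Fin n → ℝ → ℝ) : Set ℂ :=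
  {μ | ∃ ρ : ℂ, Δ p μ ρ = 0 ∧ deriv (fun r : ℂ => Δ p μ r) ρ = 0}

/-- The part of `𝓡(L)` over the complement of the discriminant set. There `μ` is a local
coordinate, so this is the Riemann surface of the function `ρ(μ)` without a discrete set of points
(the points over the discriminant set, where sheets ramify or where distinct sheets of the Riemann
surface pass through one point of `ℂ × ℂ`). A Riemann surface is connected if and only if it is
connected after the removal of such a set. -/
def unramifiedPart {n : ℕ} (p : Fin n → ℝ → ℝ) : Set (ℂ × ℂ) :=
  {z | z ∈ surface p ∧ z.1 ∉ discriminantSet p}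

end PeriodicOperator

/-!
# The Riemann surface of the multipliers of a periodic differential operator

On suitable circles of large radius `|μ|` the `2n` multipliers (the eigenvalues of the monodromy
matrix `U(μ)`) behave like those of the unperturbed operator `(-1)^n D^(2n)`. With
`μ = (-1)^n z^(2n)` these are the numbers `e^{πωz}`, `ω` running over the `2n`-th roots of unity.
When `z` runs once around a circle `|z| = R`, the parameter `μ` runs `2n` times around its circle,
and `e^{πz}` passes through all the `e^{πωz}`. So one closed curve on the surface visits every
point of a fibre, and this is what forces connectedness.

The numbers `e^{πωz}` differ wildly in size, so a comparison of characteristic polynomials would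
need precise exponential bounds. The proof works with the relative distance instead.

* There are arbitrarily large radii `R` such that on `|z| = R` any two of the numbers `e^{πωz}` have
  a distance of at least `δ` times the larger modulus (`exists_circle_separated`). Indeed
  `1 - e^w` is small only if `|w|` is close to `2π` times an integer, and a recurrence argument
  keeps the finitely many `|ω - ω'| R / 2` away from the integers.
* If `ρ` has a relative distance of at least `c` to all `e^{πωz}` and `|z|` is large, then `ρ` is
  not a multiplier (`IsCaratheodorySolution.eq_zero_of_separated`). For a solution with
  `Y(π) = ρ Y(0)`, factor `D^N - z^N = (D - ωz) ∑_j (ωz)^(N-1-j) D^j`: each `∑_j (ωz)^(N-1-j) y^(j)`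
  solves a scalar first order equation, for which the quasi-periodicity yields an a priori bound
  with the constant `1 + 1 / c` (`norm_exp_mul_le_of_quasiperiodic`). The lower order terms have
  order at most `N - 2`, hence cost a factor `1 / |z|`, and the bound becomes a contraction.
* Multiply the lower order coefficients by `s ∈ [0, 1]`. By the previous item no multiplier crosses
  the boundary of the disc of radius `(δ / 4) |e^{πωz}|` around `e^{πωz}`, and roots of monic
  polynomials depend continuously on parameters, so each of these pairwise disjoint discs contains a
  multiplier at `s = 1` (`exists_circle_multipliers`). There are `2n` discs, so each contains
  exactly one multiplier, and it depends continuously on `z`.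

Hence the unramified part contains a path-connected set which covers a full fibre
(`exists_isPathConnected_full_fibre`). In particular the discriminant of the characteristic
polynomial of `U(μ)`, which is entire in `μ`, does not vanish identically, and its zeros do not
accumulate. Off its zeros the surface consists locally of graphs of continuous functions, so by
connectedness of the complement of a countable set every point of the unramified part is joined to
the distinguished fibre (`isPathConnected_unramifiedPart`). Continuity of the roots shows that the
surface lies in the closure of its unramified part, so it is connected as well.

The link with the differential equation is classical: a solution of `L y = μ y` is the same as a
Carathéodory solution of a companion system with locally integrable coefficients
(`IsSolution.isCaratheodorySolution_jet`, `isSolution_of_isCaratheodorySolution`), because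
`(p_j y^(j))^(j)` can be expanded by the Leibniz rule almost everywhere. Solutions of such systems
are given by Picard series, whose terms are polynomials in `μ`.
-/

open MeasureTheory Set Filter Topology

namespace PeriodicOperator

/-! ### Locally absolutely continuous functions -/

theorem intervalIntegrable_of_locallyIntegrable {E : Type*} [NormedAddCommGroup E] {f : ℝ → E}
    (hf : LocallyIntegrable f volume) (a b : ℝ) : IntervalIntegrable f volume a b :=
  intervalIntegrable_iff.mpr <|
    (hf.integrableOn_isCompact isCompact_uIcc).mono_set uIoc_subset_uIcc

theorem locallyIntegrable_norm {E : Type*} [NormedAddCommGroup E] {f : ℝ → E}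
    (hf : LocallyIntegrable f volume) : LocallyIntegrable (fun x => ‖f x‖) volume :=
  locallyIntegrableOn_univ.mp (locallyIntegrableOn_univ.mpr hf).norm

theorem absolutelyContinuousOnInterval_of_dist_le {X Y : Type*} [PseudoMetricSpace X]
    [PseudoMetricSpace Y] {f : ℝ → X} {g : ℝ → Y} {a b : ℝ}
    (hg : AbsolutelyContinuousOnInterval g a b) (h : ∀ x y, dist (f x) (f y) ≤ dist (g x) (g y)) :
    AbsolutelyContinuousOnInterval f a b := by
  rw [absolutelyContinuousOnInterval_iff] at hg ⊢
  intro ε hε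
  obtain ⟨δ, hδ, H⟩ := hg ε hε
  exact ⟨δ, hδ, fun E hE hlt =>
    (Finset.sum_le_sum fun i _ => h _ _).trans_lt (H E hE hlt)⟩

theorem absolutelyContinuousOnInterval_integral {E : Type*} [NormedAddCommGroup E]
    [NormedSpace ℝ E] {f : ℝ → E} (hf : LocallyIntegrable f volume) (c a b : ℝ) :
    AbsolutelyContinuousOnInterval (fun x => ∫ t in c..x, f t) a b := by
  have hI := intervalIntegrable_of_locallyIntegrable hf
  have hn := fun a b => (hI a b).norm
  have h1 : AbsolutelyContinuousOnInterval (fun x => ∫ t in a..x, ‖f t‖) a b :=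
    (hn a b).absolutelyContinuousOnInterval_intervalIntegral left_mem_uIcc
  refine absolutelyContinuousOnInterval_of_dist_le h1 fun x y => ?_
  rw [dist_eq_norm, Real.dist_eq, intervalIntegral.integral_interval_sub_left (hI _ _) (hI _ _),
    intervalIntegral.integral_interval_sub_left (hn _ _) (hn _ _)]
  exact intervalIntegral.norm_integral_le_abs_integral_norm

/-- The fundamental theorem of calculus for a vector-valued absolutely continuous function whose
almost everywhere derivative is known. -/
theorem integral_eq_sub_of_ae_hasDerivAt {E : Type*} [NormedAddCommGroup E]
    [NormedSpace ℝ E] [CompleteSpace E] {f g : ℝ → E} {a b : ℝ}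
    (hf : AbsolutelyContinuousOnInterval f a b) (hg : LocallyIntegrable g volume)
    (h : ∀ᵐ x, HasDerivAt f (g x) x) : ∫ x in a..b, g x = f b - f a := by
  have hac := hf.sub (absolutelyContinuousOnInterval_integral hg a a b)
  obtain ⟨C, hC⟩ := hac.const_of_ae_hasDerivAt_zero (by
    filter_upwards [h, _root_.LocallyIntegrable.ae_hasDerivAt_integral hg] with x h1 h2 _
    simpa using h1.sub (h2 a))
  have h1 := hC a left_mem_uIcc
  have h2 := hC b right_mem_uIcc
  simp only [Pi.sub_apply, intervalIntegral.integral_same, sub_zero] at h1 h2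
  rw [h1, ← h2]; abel

theorem ae_differentiableAt_of_absolutelyContinuous {f : ℝ → ℂ}
    (hf : ∀ a b, AbsolutelyContinuousOnInterval f a b) : ∀ᵐ x, DifferentiableAt ℝ f x := by
  have key : ∀ g : ℝ → ℝ, (∀ a b, AbsolutelyContinuousOnInterval g a b) →
      ∀ᵐ x, DifferentiableAt ℝ g x := by
    intro g hg
    have h : ∀ᵐ x, ∀ k : ℕ, x ∈ uIcc (-(k : ℝ)) k → DifferentiableAt ℝ g x :=
      ae_all_iff.mpr fun k => (hg _ _).ae_differentiableAt
    filter_upwards [h] with x hx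
    obtain ⟨k, hk⟩ := exists_nat_ge |x|
    refine hx k ?_
    rw [uIcc_of_le (by linarith [abs_nonneg x])]
    exact abs_le.mp hk
  have hre := key (fun x => (f x).re) fun a b =>
    absolutelyContinuousOnInterval_of_dist_le (hf a b) fun x y => by
      rw [Real.dist_eq, dist_eq_norm, ← Complex.sub_re]; exact Complex.abs_re_le_norm _
  have him := key (fun x => (f x).im) fun a b =>
    absolutelyContinuousOnInterval_of_dist_le (hf a b) fun x y => by
      rw [Real.dist_eq, dist_eq_norm, ← Complex.sub_im]; exact Complex.abs_im_le_norm _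
  filter_upwards [hre, him] with x h1 h2
  have h3 := (Complex.ofRealCLM.differentiableAt.comp x h1).add
    ((Complex.ofRealCLM.differentiableAt.comp x h2).mul_const Complex.I)
  refine h3.congr_of_eventuallyEq (Eventually.of_forall fun y => ?_)
  simp

theorem continuous_integral_of_locallyIntegrable {E : Type*} [NormedAddCommGroup E]
    [NormedSpace ℝ E] {f : ℝ → E} (hf : LocallyIntegrable f volume) (c : ℝ) :
    Continuous fun x => ∫ t in c..x, f t :=
  intervalIntegral.continuous_primitive (intervalIntegrable_of_locallyIntegrable hf) c

/-! ### Carathéodory solutions of linear systems -/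

section Volterra

variable {E : Type*} [NormedAddCommGroup E] [NormedSpace ℂ E]

theorem locallyIntegrable_clm_apply {A : ℝ → E →L[ℂ] E} {f : ℝ → E}
    (hA : LocallyIntegrable A volume) (hf : Continuous f) :
    LocallyIntegrable (fun t => A t (f t)) volume := by
  rw [locallyIntegrable_iff]
  intro K hK
  obtain ⟨C, hC⟩ := hK.exists_bound_of_continuousOn hf.continuousOn
  have hAK := hA.integrableOn_isCompact hK
  refine Integrable.mono' (hAK.norm.mul_const C) ?_ ?_
  · have happ := (isBoundedBilinearMap_apply (𝕜 := ℂ) (E := E) (F := E)).continuous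
    exact happ.comp_aestronglyMeasurable
      (hAK.aestronglyMeasurable.prodMk
        (hf.continuousOn.aestronglyMeasurable_of_isCompact hK hK.measurableSet))
  · filter_upwards [ae_restrict_mem hK.measurableSet] with t ht
    exact (A t).le_of_opNorm_le_of_le le_rfl (hC t ht)

/-- Carathéodory solutions of the linear system `Y' = A(x) Y`, as solutions of the integral
equation. -/
def IsCaratheodorySolution (A : ℝ → E →L[ℂ] E) (Y : ℝ → E) : Prop :=
  Continuous Y ∧ ∀ x, Y x = Y 0 + ∫ t in (0 : ℝ)..x, A t (Y t)

/-- The terms of the Picard series of the solution of `Y' = A(x) Y`, `Y(0) = c`. -/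
noncomputable def picardTerm (A : ℝ → E →L[ℂ] E) (c : E) : ℕ → ℝ → E
  | 0 => fun _ => c
  | k + 1 => fun x => ∫ t in (0 : ℝ)..x, A t (picardTerm A c k t)

theorem continuous_picardTerm {A : ℝ → E →L[ℂ] E} (hA : LocallyIntegrable A volume) (c : E)
    (k : ℕ) : Continuous (picardTerm A c k) := by
  induction k with
  | zero => exact continuous_const
  | succ k ih =>
    exact continuous_integral_of_locallyIntegrable (locallyIntegrable_clm_apply hA ih) 0

theorem integral_mul_pow_integral {a : ℝ → ℝ} (ha : LocallyIntegrable a volume) (k : ℕ) (x : ℝ) :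
    ∫ t in (0 : ℝ)..x, a t * (∫ s in (0 : ℝ)..t, a s) ^ k
      = (∫ s in (0 : ℝ)..x, a s) ^ (k + 1) / (k + 1) := by
  have hac := absolutelyContinuousOnInterval_integral ha 0 0 x
  have hpow : ∀ m : ℕ, AbsolutelyContinuousOnInterval
      (fun t => (∫ s in (0 : ℝ)..t, a s) ^ (m + 1)) 0 x := by
    intro m
    induction m with
    | zero => simpa using hac
    | succ m ih =>
      simp only [pow_succ _ (m + 1)]
      exact ih.fun_mul hac
  have hk : (k + 1 : ℝ) ≠ 0 := by positivity
  have := integral_eq_sub_of_ae_hasDerivAt (hpow k)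
    (g := fun t => (k + 1 : ℝ) * (a t * (∫ s in (0 : ℝ)..t, a s) ^ k)) ?_ ?_
  · rw [intervalIntegral.integral_const_mul] at this
    rw [eq_div_iff hk, mul_comm, this]; simp
  · exact (ha.mul_continuous ((continuous_integral_of_locallyIntegrable ha 0).pow k)).smul
      (k + 1 : ℝ)
  · filter_upwards [_root_.LocallyIntegrable.ae_hasDerivAt_integral ha] with t ht
    convert! (ht 0).pow (k + 1) using 1
    push_cast
    ring

/-- The inductive step of the bound for iterates of the Volterra operator `f ↦ ∫₀ˣ A f`. -/
theorem norm_integral_clm_apply_le {A : ℝ → E →L[ℂ] E} {a : ℝ → ℝ} {f : ℝ → E}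
    (ha : LocallyIntegrable a volume) (hAa : ∀ t, ‖A t‖ ≤ a t) {C : ℝ} (hC : 0 ≤ C) {k : ℕ}
    {x : ℝ} (hf : ∀ t ∈ uIcc 0 x, ‖f t‖ ≤ C * |∫ s in (0 : ℝ)..t, a s| ^ k / k.factorial) :
    ‖∫ t in (0 : ℝ)..x, A t (f t)‖
      ≤ C * |∫ s in (0 : ℝ)..x, a s| ^ (k + 1) / (k + 1).factorial := by
  have ha0 : ∀ t, 0 ≤ a t := fun t => (norm_nonneg _).trans (hAa t)
  have hcont := continuous_integral_of_locallyIntegrable ha 0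
  have hli : LocallyIntegrable (fun t => a t * |∫ s in (0 : ℝ)..t, a s| ^ k) volume :=
    ha.mul_continuous (hcont.abs.pow k)
  have hint : |∫ t in (0 : ℝ)..x, a t * |∫ s in (0 : ℝ)..t, a s| ^ k|
      = |∫ s in (0 : ℝ)..x, a s| ^ (k + 1) / (k + 1) := by
    have hpow : |∫ s in (0 : ℝ)..x, a s| ^ (k + 1) / (k + 1)
        = |(∫ s in (0 : ℝ)..x, a s) ^ (k + 1) / (k + 1)| := by
      rw [abs_div, abs_pow, abs_of_pos (by positivity : (0 : ℝ) < k + 1)]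
    rcases le_total 0 x with hx | hx
    · rw [hpow, ← integral_mul_pow_integral ha]
      congr 1
      refine intervalIntegral.integral_congr fun t ht => ?_
      rw [uIcc_of_le hx] at ht
      rw [abs_of_nonneg (intervalIntegral.integral_nonneg ht.1 fun s _ => ha0 s)]
    · rw [hpow, ← integral_mul_pow_integral ha]
      have : ∀ t ∈ uIcc 0 x, a t * |∫ s in (0 : ℝ)..t, a s| ^ k
          = (-1) ^ k * (a t * (∫ s in (0 : ℝ)..t, a s) ^ k) := by
        intro t ht
        rw [uIcc_of_ge hx] at ht
        have : ∫ s in (0 : ℝ)..t, a s ≤ 0 := by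
          rw [intervalIntegral.integral_symm, neg_nonpos]
          exact intervalIntegral.integral_nonneg ht.2 fun s _ => ha0 s
        rw [abs_of_nonpos this, neg_pow]; ring
      rw [intervalIntegral.integral_congr this, intervalIntegral.integral_const_mul, abs_mul]
      simp
  calc ‖∫ t in (0 : ℝ)..x, A t (f t)‖
      ≤ |∫ t in (0 : ℝ)..x, C / k.factorial * (a t * |∫ s in (0 : ℝ)..t, a s| ^ k)| := by
        refine intervalIntegral.norm_integral_le_abs_of_norm_le ?_
          ((intervalIntegrable_of_locallyIntegrable hli 0 x).const_mul _)
        filter_upwards [ae_restrict_mem measurableSet_uIoc] with t ht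
        refine ((A t).le_of_opNorm_le_of_le (hAa t) (hf t (uIoc_subset_uIcc ht))).trans_eq ?_
        ring
    _ = |C / k.factorial| * (|∫ s in (0 : ℝ)..x, a s| ^ (k + 1) / (k + 1)) := by
        rw [intervalIntegral.integral_const_mul, abs_mul, hint]
    _ = C * |∫ s in (0 : ℝ)..x, a s| ^ (k + 1) / (k + 1).factorial := by
        rw [abs_of_nonneg (by positivity), Nat.factorial_succ]
        push_cast
        field_simp

theorem norm_picardTerm_le {A : ℝ → E →L[ℂ] E} {a : ℝ → ℝ} (ha : LocallyIntegrable a volume)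
    (hAa : ∀ t, ‖A t‖ ≤ a t) (c : E) (k : ℕ) (x : ℝ) :
    ‖picardTerm A c k x‖ ≤ ‖c‖ * |∫ s in (0 : ℝ)..x, a s| ^ k / k.factorial := by
  induction k generalizing x with
  | zero => simp [picardTerm]
  | succ k ih => exact norm_integral_clm_apply_le ha hAa (norm_nonneg c) fun t _ => ih t

theorem exists_bound_abs_integral {a : ℝ → ℝ} (ha : LocallyIntegrable a volume) (R : ℝ) :
    ∃ M, 0 ≤ M ∧ ∀ t ∈ Metric.closedBall (0 : ℝ) R, |∫ s in (0 : ℝ)..t, a s| ≤ M := by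
  obtain ⟨M, hM⟩ := (isCompact_closedBall (0 : ℝ) R).exists_bound_of_continuousOn
    (continuous_integral_of_locallyIntegrable ha 0).continuousOn
  exact ⟨max M 0, le_max_right _ _, fun t ht => (hM t ht).trans (le_max_left _ _)⟩

/-- A summable majorant of the Picard terms on a compact interval which is uniform over all
coefficients `A` dominated by the same locally integrable function. -/
theorem exists_bound_picardTerm {a : ℝ → ℝ} (ha : LocallyIntegrable a volume) (c : E) (R : ℝ) :
    ∃ u : ℕ → ℝ, Summable u ∧ ∀ A : ℝ → E →L[ℂ] E, (∀ t, ‖A t‖ ≤ a t) →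
      ∀ k, ∀ t ∈ Metric.closedBall (0 : ℝ) R, ‖picardTerm A c k t‖ ≤ u k := by
  obtain ⟨M, hM0, hM⟩ := exists_bound_abs_integral ha R
  refine ⟨fun k => ‖c‖ * (M ^ k / k.factorial), (Real.summable_pow_div_factorial M).mul_left _,
    fun A hA k t ht => (norm_picardTerm_le ha hA c k t).trans ?_⟩
  rw [mul_div_assoc]
  change _ ≤ ‖c‖ * (M ^ k / k.factorial)
  gcongr
  exact hM t ht

/-- The sum of the Picard series: the solution of `Y' = A(x) Y`, `Y(0) = c`. -/
noncomputable def caratheodorySolution (A : ℝ → E →L[ℂ] E) (c : E) (x : ℝ) : E :=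
  ∑' k, picardTerm A c k x

theorem caratheodorySolution_zero (A : ℝ → E →L[ℂ] E) (c : E) :
    caratheodorySolution A c 0 = c := by
  rw [caratheodorySolution, tsum_eq_single 0]
  · rfl
  · intro k hk
    obtain ⟨k, rfl⟩ := Nat.exists_eq_succ_of_ne_zero hk
    simp [picardTerm]

theorem isCaratheodorySolution_caratheodorySolution [CompleteSpace E] {A : ℝ → E →L[ℂ] E}
    (hA : LocallyIntegrable A volume) (c : E) :
    IsCaratheodorySolution A (caratheodorySolution A c) := by
  have hcont : Continuous (caratheodorySolution A c) := by
    rw [continuous_iff_continuousAt]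
    intro x
    obtain ⟨u, hu, hb⟩ := exists_bound_picardTerm (locallyIntegrable_norm hA) c (|x| + 1)
    have : ContinuousOn (caratheodorySolution A c) (Metric.closedBall 0 (|x| + 1)) :=
      continuousOn_tsum (fun k => (continuous_picardTerm hA c k).continuousOn) hu
        (hb A fun t => le_rfl)
    refine this.continuousAt (Metric.closedBall_mem_nhds_of_mem ?_)
    simp
  refine ⟨hcont, fun x => ?_⟩
  obtain ⟨u, hu, hb⟩ := exists_bound_picardTerm (locallyIntegrable_norm hA) c |x|
  have hsub : ∀ t ∈ uIoc 0 x, t ∈ Metric.closedBall (0 : ℝ) |x| := by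
    intro t ht
    have := abs_sub_left_of_mem_uIcc (uIoc_subset_uIcc ht)
    simpa using this
  have hsum : ∀ t ∈ Metric.closedBall (0 : ℝ) |x|, Summable fun k => picardTerm A c k t :=
    fun t ht => Summable.of_norm_bounded hu fun k => hb A (fun t => le_rfl) k t ht
  have hS := intervalIntegral.hasSum_integral_of_dominated_convergence (μ := volume) (a := 0)
    (b := x) (F := fun k t => A t (picardTerm A c k t))
    (f := fun t => A t (caratheodorySolution A c t)) (fun k t => ‖A t‖ * u k)
    (fun k => (intervalIntegrable_of_locallyIntegrable (locallyIntegrable_clm_apply hA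
      (continuous_picardTerm hA c k)) 0 x).aestronglyMeasurable_restrict_uIoc)
    (fun k => Eventually.of_forall fun t ht =>
      (A t).le_of_opNorm_le_of_le le_rfl (hb A (fun t => le_rfl) k t (hsub t ht)))
    (Eventually.of_forall fun t _ => hu.mul_left _)
    (by
      simp only [tsum_mul_left]
      exact (intervalIntegrable_of_locallyIntegrable (locallyIntegrable_norm hA) 0 x).mul_const _)
    (Eventually.of_forall fun t ht => (A t).hasSum (hsum t (hsub t ht)).hasSum)
  rw [caratheodorySolution_zero, ← hS.tsum_eq, caratheodorySolution,
    (hsum x (by simp)).tsum_eq_zero_add]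
  rfl

/-- Uniqueness: the difference of two solutions is a fixed point of the Volterra operator, whose
iterates tend to zero. -/
theorem IsCaratheodorySolution.eq_of_eq_zero {A : ℝ → E →L[ℂ] E}
    (hA : LocallyIntegrable A volume) {Y Z : ℝ → E} (hY : IsCaratheodorySolution A Y)
    (hZ : IsCaratheodorySolution A Z) (h0 : Y 0 = Z 0) : Y = Z := by
  have hD : ∀ x, Y x - Z x = ∫ t in (0 : ℝ)..x, A t (Y t - Z t) := by
    intro x
    rw [hY.2 x, hZ.2 x, h0, add_sub_add_left_eq_sub, ← intervalIntegral.integral_sub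
      (intervalIntegrable_of_locallyIntegrable (locallyIntegrable_clm_apply hA hY.1) 0 x)
      (intervalIntegrable_of_locallyIntegrable (locallyIntegrable_clm_apply hA hZ.1) 0 x)]
    simp
  funext x
  obtain ⟨C, hC⟩ := (isCompact_uIcc (a := (0 : ℝ)) (b := x)).exists_bound_of_continuousOn
    (hY.1.sub hZ.1).continuousOn
  have hC0 : 0 ≤ C := (norm_nonneg _).trans (hC 0 left_mem_uIcc)
  have hb : ∀ k : ℕ, ∀ y ∈ uIcc 0 x,
      ‖Y y - Z y‖ ≤ C * |∫ s in (0 : ℝ)..y, ‖A s‖| ^ k / k.factorial := by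
    intro k
    induction k with
    | zero => intro y hy; simpa using hC y hy
    | succ k ih =>
      intro y hy
      rw [hD y]
      exact norm_integral_clm_apply_le (locallyIntegrable_norm hA) (fun t => le_rfl) hC0 fun t ht =>
        ih t (uIcc_subset_uIcc_left hy ht)
  have hlim : Tendsto (fun k : ℕ => C * |∫ s in (0 : ℝ)..x, ‖A s‖| ^ k / k.factorial) atTop
      (𝓝 0) := by
    simpa [mul_div_assoc] using
      (FloorSemiring.tendsto_pow_div_factorial_atTop |∫ s in (0 : ℝ)..x, ‖A s‖|).const_mul C
  have := ge_of_tendsto' hlim fun k => hb k x right_mem_uIcc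
  exact sub_eq_zero.mp (norm_le_zero_iff.mp this)

/-- The Picard terms of `A₀ + ζ A₁` are polynomials in `ζ`. -/
theorem exists_picardTerm_eq_sum {A₀ A₁ : ℝ → E →L[ℂ] E} (h₀ : LocallyIntegrable A₀ volume)
    (h₁ : LocallyIntegrable A₁ volume) (c : E) (k : ℕ) :
    ∃ (ι : Type) (_ : Fintype ι) (e : ι → ℕ) (g : ι → ℝ → E), (∀ i, Continuous (g i)) ∧
      ∀ (ζ : ℂ) (x : ℝ), picardTerm (fun t => A₀ t + ζ • A₁ t) c k x = ∑ i, ζ ^ e i • g i x := by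
  induction k with
  | zero => exact ⟨Unit, inferInstance, fun _ => 0, fun _ _ => c, fun _ => continuous_const,
      fun ζ x => by simp [picardTerm]⟩
  | succ k ih =>
    obtain ⟨ι, _, e, g, hg, h⟩ := ih
    refine ⟨ι ⊕ ι, inferInstance, Sum.elim e fun i => e i + 1,
      Sum.elim (fun i x => ∫ t in (0 : ℝ)..x, A₀ t (g i t))
        fun i x => ∫ t in (0 : ℝ)..x, A₁ t (g i t), ?_, fun ζ x => ?_⟩
    · rintro (i | i)
      · exact continuous_integral_of_locallyIntegrable (locallyIntegrable_clm_apply h₀ (hg i)) 0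
      · exact continuous_integral_of_locallyIntegrable (locallyIntegrable_clm_apply h₁ (hg i)) 0
    · have hI₀ : ∀ i, IntervalIntegrable (fun t => ζ ^ e i • A₀ t (g i t)) volume 0 x :=
        fun i => (intervalIntegrable_of_locallyIntegrable
          (locallyIntegrable_clm_apply h₀ (hg i)) 0 x).smul (ζ ^ e i)
      have hI₁ : ∀ i, IntervalIntegrable (fun t => ζ ^ (e i + 1) • A₁ t (g i t)) volume 0 x :=
        fun i => (intervalIntegrable_of_locallyIntegrable
          (locallyIntegrable_clm_apply h₁ (hg i)) 0 x).smul (ζ ^ (e i + 1))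
      have : ∀ t, (A₀ t + ζ • A₁ t) (picardTerm (fun t => A₀ t + ζ • A₁ t) c k t)
          = ∑ i, (ζ ^ e i • A₀ t (g i t) + ζ ^ (e i + 1) • A₁ t (g i t)) := by
        intro t
        rw [h ζ t, map_sum]
        refine Finset.sum_congr rfl fun i _ => ?_
        simp [pow_succ, smul_smul]
      simp only [picardTerm, this, Fintype.sum_sum_type, Sum.elim_inl, Sum.elim_inr]
      rw [intervalIntegral.integral_finsetSum fun i _ => (hI₀ i).add (hI₁ i),
        ← Finset.sum_add_distrib]
      refine Finset.sum_congr rfl fun i _ => ?_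
      rw [intervalIntegral.integral_add (hI₀ i) (hI₁ i),
        intervalIntegral.integral_smul, intervalIntegral.integral_smul]

/-- The solution of `Y' = (A₀(x) + ζ A₁(x)) Y` with a fixed initial value is entire in `ζ`. -/
theorem differentiable_caratheodorySolution [CompleteSpace E] {A₀ A₁ : ℝ → E →L[ℂ] E}
    (h₀ : LocallyIntegrable A₀ volume) (h₁ : LocallyIntegrable A₁ volume) (c : E) (x : ℝ) :
    Differentiable ℂ fun ζ : ℂ => caratheodorySolution (fun t => A₀ t + ζ • A₁ t) c x := by
  intro ζ₀
  obtain ⟨u, hu, hb⟩ := exists_bound_picardTerm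
    ((locallyIntegrable_norm h₀).add ((locallyIntegrable_norm h₁).smul (‖ζ₀‖ + 1))) c |x|
  have hd : DifferentiableOn ℂ
      (fun ζ : ℂ => caratheodorySolution (fun t => A₀ t + ζ • A₁ t) c x)
      (Metric.ball 0 (‖ζ₀‖ + 1)) := by
    refine Complex.differentiableOn_tsum_of_summable_norm hu (fun k => ?_) Metric.isOpen_ball
      fun k ζ hζ => hb _ (fun t => ?_) k x (by simp)
    · obtain ⟨ι, _, e, g, -, h⟩ := exists_picardTerm_eq_sum h₀ h₁ c k
      simp only [h]
      fun_prop
    · refine (norm_add_le _ _).trans ?_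
      change _ ≤ ‖A₀ t‖ + (‖ζ₀‖ + 1) * ‖A₁ t‖
      rw [norm_smul]
      gcongr
      simpa using (mem_ball_zero_iff.mp hζ).le
  exact hd.differentiableAt (Metric.isOpen_ball.mem_nhds (by simp))

end Volterra

/-! ### Companion systems -/

section Companion

theorem locallyIntegrable_sum_smul_const {ι F : Type*} [Fintype ι] [NormedAddCommGroup F]
    [NormedSpace ℂ F] {q : ι → ℝ → ℂ} (hq : ∀ l, LocallyIntegrable (q l) volume) (T : ι → F) :
    LocallyIntegrable (fun t => ∑ l, q l t • T l) volume := by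
  refine locallyIntegrable_finsetSum _ fun l _ => ?_
  exact locallyIntegrableOn_univ.mp
    (((ContinuousLinearMap.id ℂ ℂ).smulRight (T l)).locallyIntegrableOn_comp
      (locallyIntegrableOn_univ.mpr (hq l)))

variable {N : ℕ}

/-- The shift `Y ↦ (Y₁, …, Y_{N-1}, 0)`. -/
noncomputable def shiftOp (N : ℕ) : (Fin N → ℂ) →L[ℂ] (Fin N → ℂ) :=
  ContinuousLinearMap.pi fun i =>
    if h : (i : ℕ) + 1 < N then ContinuousLinearMap.proj (⟨i + 1, h⟩ : Fin N) else 0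

/-- The operator `Y ↦ (0, …, 0, Y_l)`. -/
noncomputable def lastRowOp (l : Fin N) : (Fin N → ℂ) →L[ℂ] (Fin N → ℂ) :=
  ContinuousLinearMap.pi fun i =>
    if (i : ℕ) + 1 < N then 0 else ContinuousLinearMap.proj l

/-- The part `Y ↦ (0, …, 0, ∑ q_l(t) Y_l)` of the companion system. -/
noncomputable def coeffOp (q : Fin N → ℝ → ℂ) (t : ℝ) : (Fin N → ℂ) →L[ℂ] (Fin N → ℂ) :=
  ∑ l, q l t • lastRowOp l

/-- The first order system for `(y, y', …, y^(N-1))` equivalent to `y^(N) = ∑ q_l(t) y^(l)`. -/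
noncomputable def companionOp (q : Fin N → ℝ → ℂ) (t : ℝ) : (Fin N → ℂ) →L[ℂ] (Fin N → ℂ) :=
  shiftOp N + coeffOp q t

theorem companionOp_apply_of_lt (q : Fin N → ℝ → ℂ) (t : ℝ) (Y : Fin N → ℂ) {i : Fin N}
    (h : (i : ℕ) + 1 < N) : companionOp q t Y i = Y ⟨i + 1, h⟩ := by
  simp [companionOp, shiftOp, coeffOp, lastRowOp, h]

theorem companionOp_apply_of_not_lt (q : Fin N → ℝ → ℂ) (t : ℝ) (Y : Fin N → ℂ) {i : Fin N}
    (h : ¬ (i : ℕ) + 1 < N) : companionOp q t Y i = ∑ l, q l t * Y l := by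
  simp [companionOp, shiftOp, coeffOp, lastRowOp, h]

theorem companionOp_add_mul (q₀ q₁ : Fin N → ℝ → ℂ) (ζ : ℂ) :
    companionOp (fun l t => q₀ l t + ζ * q₁ l t)
      = fun t => companionOp q₀ t + ζ • coeffOp q₁ t := by
  funext t
  simp only [companionOp, coeffOp, Finset.smul_sum, add_assoc, ← Finset.sum_add_distrib]
  congr 1
  refine Finset.sum_congr rfl fun l _ => ?_
  have h := add_smul (q₀ l t) (ζ * q₁ l t) (lastRowOp l)
  rw [h]
  exact congrArg _ (mul_smul ζ (q₁ l t) (lastRowOp l))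

theorem locallyIntegrable_coeffOp {q : Fin N → ℝ → ℂ} (hq : ∀ l, LocallyIntegrable (q l) volume) :
    LocallyIntegrable (coeffOp q) volume := by
  exact locallyIntegrable_sum_smul_const hq lastRowOp

theorem locallyIntegrable_companionOp {q : Fin N → ℝ → ℂ}
    (hq : ∀ l, LocallyIntegrable (q l) volume) : LocallyIntegrable (companionOp q) volume :=
  (locallyIntegrable_const (shiftOp N)).add (locallyIntegrable_coeffOp hq)

/-- The value at `x` of the solutions of the companion system: row `k` is the solution with
initial value the `k`-th unit vector. -/
noncomputable def solutionMatrix (q : Fin N → ℝ → ℂ) (x : ℝ) : Matrix (Fin N) (Fin N) ℂ :=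
  Matrix.of fun k => caratheodorySolution (companionOp q) (Pi.single k 1) x

theorem IsCaratheodorySolution.eq_vecMul_solutionMatrix {q : Fin N → ℝ → ℂ}
    (hq : ∀ l, LocallyIntegrable (q l) volume) {Y : ℝ → Fin N → ℂ}
    (hY : IsCaratheodorySolution (companionOp q) Y) (x : ℝ) :
    Y x = Matrix.vecMul (Y 0) (solutionMatrix q x) := by
  have hA := locallyIntegrable_companionOp hq
  have hS := fun k : Fin N =>
    isCaratheodorySolution_caratheodorySolution hA (Pi.single k (1 : ℂ))
  have hZ : IsCaratheodorySolution (companionOp q)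
      (fun x => ∑ k, Y 0 k • caratheodorySolution (companionOp q) (Pi.single k 1) x) := by
    refine ⟨continuous_finsetSum _ fun k _ => (hS k).1.const_smul (Y 0 k), fun x => ?_⟩
    have hI : ∀ k, IntervalIntegrable (fun t => Y 0 k • companionOp q t
        (caratheodorySolution (companionOp q) (Pi.single k 1) t)) volume 0 x := fun k =>
      (intervalIntegrable_of_locallyIntegrable
        (locallyIntegrable_clm_apply hA (hS k).1) 0 x).smul (Y 0 k)
    simp only [map_sum, map_smul]
    rw [intervalIntegral.integral_finsetSum fun k _ => hI k, ← Finset.sum_add_distrib]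
    refine Finset.sum_congr rfl fun k _ => ?_
    rw [intervalIntegral.integral_smul, ← smul_add, ← (hS k).2 x]
  have h0 : Y 0 = ∑ k, Y 0 k • caratheodorySolution (companionOp q) (Pi.single k 1) 0 := by
    simp only [caratheodorySolution_zero]
    exact pi_eq_sum_univ' (Y 0)
  have h := congrFun (hY.eq_of_eq_zero hA hZ h0) x
  rw [h]
  funext j
  simp [Matrix.vecMul, dotProduct, solutionMatrix]

/-- The monodromy data of `y^(N) = ∑ (q₀ + ζ q₁)_l(t) y^(l)` is entire in `ζ`. -/
theorem differentiable_solutionMatrix {q₀ q₁ : Fin N → ℝ → ℂ}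
    (h₀ : ∀ l, LocallyIntegrable (q₀ l) volume) (h₁ : ∀ l, LocallyIntegrable (q₁ l) volume)
    (x : ℝ) (k j : Fin N) :
    Differentiable ℂ fun ζ : ℂ => solutionMatrix (fun l t => q₀ l t + ζ * q₁ l t) x k j := by
  have h := differentiable_caratheodorySolution (locallyIntegrable_companionOp h₀)
    (locallyIntegrable_coeffOp h₁) (Pi.single k (1 : ℂ)) x
  simp only [solutionMatrix, companionOp_add_mul, Matrix.of_apply]
  exact differentiable_pi.mp h j

theorem IsCaratheodorySolution.apply_eq {q : Fin N → ℝ → ℂ}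
    (hq : ∀ l, LocallyIntegrable (q l) volume) {Y : ℝ → Fin N → ℂ}
    (hY : IsCaratheodorySolution (companionOp q) Y) (i : Fin N) (x : ℝ) :
    Y x i = Y 0 i + ∫ t in (0 : ℝ)..x, companionOp q t (Y t) i := by
  have hI := intervalIntegrable_of_locallyIntegrable
    (locallyIntegrable_clm_apply (locallyIntegrable_companionOp hq) hY.1) 0 x
  have h := (ContinuousLinearMap.proj (R := ℂ) (φ := fun _ : Fin N => ℂ)
    i).intervalIntegral_comp_comm hI
  have h2 := congrFun (hY.2 x) i
  simp only [ContinuousLinearMap.proj_apply] at h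
  rw [h2, Pi.add_apply, h]

theorem isCaratheodorySolution_of_apply {q : Fin N → ℝ → ℂ}
    (hq : ∀ l, LocallyIntegrable (q l) volume) {Y : ℝ → Fin N → ℂ} (hc : Continuous Y)
    (h : ∀ i x, Y x i = Y 0 i + ∫ t in (0 : ℝ)..x, companionOp q t (Y t) i) :
    IsCaratheodorySolution (companionOp q) Y := by
  refine ⟨hc, fun x => funext fun i => ?_⟩
  have hI := intervalIntegrable_of_locallyIntegrable
    (locallyIntegrable_clm_apply (locallyIntegrable_companionOp hq) hc) 0 x
  have h' := (ContinuousLinearMap.proj (R := ℂ) (φ := fun _ : Fin N => ℂ)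
    i).intervalIntegral_comp_comm hI
  simp only [ContinuousLinearMap.proj_apply] at h'
  rw [Pi.add_apply, ← h', ← h i x]

end Companion

/-! ### The expanded form of the differential expression -/

section Reduction

theorem deriv_ofReal_comp (f : ℝ → ℝ) (x : ℝ) :
    deriv (fun t => (f t : ℂ)) x = ((deriv f x : ℝ) : ℂ) := by
  by_cases h : DifferentiableAt ℝ f x
  · exact h.hasDerivAt.ofReal_comp.deriv
  · rw [deriv_zero_of_not_differentiableAt h, deriv_zero_of_not_differentiableAt]
    · simp
    · intro h'
      exact h (Complex.reCLM.differentiableAt.comp x h')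

theorem iteratedDeriv_ofReal_comp (f : ℝ → ℝ) (k : ℕ) :
    iteratedDeriv k (fun t => (f t : ℂ)) = fun t => ((iteratedDeriv k f t : ℝ) : ℂ) := by
  induction k with
  | zero => simp
  | succ k ih =>
    rw [iteratedDeriv_succ, ih, iteratedDeriv_succ]
    exact funext fun x => deriv_ofReal_comp _ x

/-- The Leibniz rule at a point where the last derivative of the first factor exists although
that factor need not be `j` times differentiable nearby. -/
theorem iteratedDeriv_mul_of_differentiableAt {f g : ℝ → ℂ} {j : ℕ} {x : ℝ}
    (hf : ∀ i < j, ContDiff ℝ i f)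
    (hd : ∀ i < j, DifferentiableAt ℝ (iteratedDeriv i f) x) (hg : ContDiff ℝ j g) :
    iteratedDeriv j (fun t => f t * g t) x = ∑ i ∈ Finset.range (j + 1),
      (j.choose i : ℂ) * (iteratedDeriv i f x * iteratedDeriv (j - i) g x) := by
  cases j with
  | zero => simp
  | succ k =>
    have hfk := hf k (Nat.lt_succ_self k)
    have hgk : ContDiff ℝ k g := hg.of_le (by exact_mod_cast Nat.le_succ k)
    have h1 : iteratedDeriv k (fun t => f t * g t) = fun t => ∑ i ∈ Finset.range (k + 1),
        (k.choose i : ℂ) * (iteratedDeriv i f t * iteratedDeriv (k - i) g t) := by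
      funext t
      rw [iteratedDeriv_fun_mul hfk.contDiffAt hgk.contDiffAt]
      simp only [mul_assoc]
    have hgd : ∀ i ≤ k, DifferentiableAt ℝ (iteratedDeriv i g) x := fun i hi =>
      ((contDiff_nat_iff_iteratedDeriv.mp hg).2 i (by omega)) x
    rw [iteratedDeriv_succ, h1, Finset.sum_choose_succ_mul
      (fun a b => iteratedDeriv a f x * iteratedDeriv b g x), ← Finset.sum_add_distrib]
    have h2 : HasDerivAt (fun t => ∑ i ∈ Finset.range (k + 1),
        (k.choose i : ℂ) * (iteratedDeriv i f t * iteratedDeriv (k - i) g t))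
        (∑ i ∈ Finset.range (k + 1), (k.choose i : ℂ) *
          (deriv (iteratedDeriv i f) x * iteratedDeriv (k - i) g x
            + iteratedDeriv i f x * deriv (iteratedDeriv (k - i) g) x)) x := by
      refine HasDerivAt.fun_sum fun i hi => HasDerivAt.const_mul _ ?_
      exact (hd i (Finset.mem_range.mp hi)).hasDerivAt.mul (hgd (k - i) (by omega)).hasDerivAt
    rw [h2.deriv]
    refine Finset.sum_congr rfl fun i hi => ?_
    have : k + 1 - i = (k - i) + 1 := by have := Finset.mem_range.mp hi; omega
    rw [this, iteratedDeriv_succ, iteratedDeriv_succ]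
    ring

variable {n : ℕ}

/-- The coefficients `r_l` of the lower order terms, when `L y = μ y` is written in the form
`y^(2n) = (-1)^n μ y + ∑ r_l y^(l)`. -/
noncomputable def lowerCoeff (p : Fin n → ℝ → ℝ) (l : Fin (2 * n)) (t : ℝ) : ℂ :=
  -((-1) ^ n * ∑ j : Fin n, ∑ i ∈ Finset.range ((j : ℕ) + 1),
    if (l : ℕ) = 2 * j - i then ((j : ℕ).choose i : ℂ) * ((iteratedDeriv i (p j) t : ℝ) : ℂ) else 0)

/-- There is no term of order `2n - 1`. This is where it matters that `L` has no term between
`(-1)^n D^(2n)` and `D^(n-1) p_{n-1} D^(n-1)`. -/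
theorem lowerCoeff_of_not_lt (p : Fin n → ℝ → ℝ) {l : Fin (2 * n)} (hl : ¬ (l : ℕ) + 1 < 2 * n)
    (t : ℝ) : lowerCoeff p l t = 0 := by
  have : ∀ (j : Fin n) (i : ℕ), (l : ℕ) ≠ 2 * j - i := fun j i => by omega
  simp [lowerCoeff, this]

theorem sum_lowerCoeff_mul (p : Fin n → ℝ → ℝ) (t : ℝ) (Y : ℕ → ℂ) :
    ∑ l : Fin (2 * n), lowerCoeff p l t * Y l
      = -((-1) ^ n * ∑ j : Fin n, ∑ i ∈ Finset.range ((j : ℕ) + 1),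
        ((j : ℕ).choose i : ℂ) * (((iteratedDeriv i (p j) t : ℝ) : ℂ) * Y (2 * j - i))) := by
  simp only [lowerCoeff, neg_mul, Finset.sum_neg_distrib, mul_assoc, ← Finset.mul_sum,
    Finset.sum_mul]
  congr 2
  rw [Finset.sum_comm]
  refine Finset.sum_congr rfl fun j _ => ?_
  rw [Finset.sum_comm]
  refine Finset.sum_congr rfl fun i _ => ?_
  have hlt : 2 * (j : ℕ) - i < 2 * n := by omega
  rw [Finset.sum_eq_single (⟨2 * j - i, hlt⟩ : Fin (2 * n))]
  · simp [mul_assoc]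
  · intro l _ hl
    rw [if_neg (fun h => hl (Fin.ext h)), zero_mul]
  · simp

theorem IsCoefficients.locallyIntegrable_iteratedDeriv {p : Fin n → ℝ → ℝ} (hp : IsCoefficients p)
    (j : Fin n) {i : ℕ} (hi : i ≤ j) : LocallyIntegrable (iteratedDeriv i (p j)) volume := by
  rcases hi.lt_or_eq with h | rfl
  · exact ((hp.hasACDerivs j i h).1.continuous_iteratedDeriv' i).locallyIntegrable
  · have hper : Function.Periodic (iteratedDeriv (j : ℕ) (p j)) Real.pi := by
      intro x
      have h := congrFun (iteratedDeriv_comp_add_const (j : ℕ) (p j) Real.pi) x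
      rw [← h]
      congr 1
      exact funext (hp.periodic j)
    have h0 : IntervalIntegrable (iteratedDeriv (j : ℕ) (p j)) volume 0 Real.pi :=
      (intervalIntegrable_iff_integrableOn_Icc_of_le Real.pi_pos.le).mpr (hp.integrable j)
    intro x
    refine ⟨Icc (x - 1) (x + 1), Icc_mem_nhds (by linarith) (by linarith), ?_⟩
    exact (intervalIntegrable_iff_integrableOn_Icc_of_le (by linarith)).mp
      (hper.intervalIntegrable₀ Real.pi_pos.ne' h0 _ _)

theorem IsCoefficients.locallyIntegrable_lowerCoeff {p : Fin n → ℝ → ℝ} (hp : IsCoefficients p)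
    (l : Fin (2 * n)) : LocallyIntegrable (lowerCoeff p l) volume := by
  have h : ∀ (j : Fin n), ∀ i ∈ Finset.range ((j : ℕ) + 1), LocallyIntegrable (fun t =>
      if (l : ℕ) = 2 * j - i then ((j : ℕ).choose i : ℂ) * ((iteratedDeriv i (p j) t : ℝ) : ℂ)
        else 0) volume := by
    intro j i hi
    split_ifs with h
    · have h1 := hp.locallyIntegrable_iteratedDeriv j (Nat.lt_succ_iff.mp (Finset.mem_range.mp hi))
      exact (locallyIntegrableOn_univ.mp (Complex.ofRealCLM.locallyIntegrableOn_comp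
        (locallyIntegrableOn_univ.mpr h1))).smul ((j : ℕ).choose i : ℂ)
    · exact locallyIntegrable_zero
  have h2 := locallyIntegrable_finsetSum Finset.univ fun (j : Fin n) _ =>
    locallyIntegrable_finsetSum _ (h j)
  exact (h2.smul ((-1 : ℂ) ^ n)).neg

/-- The differential expression in expanded form, almost everywhere. -/
theorem IsCoefficients.ae_L_eq {p : Fin n → ℝ → ℝ} (hp : IsCoefficients p) :
    ∀ᵐ x : ℝ, ∀ y : ℝ → ℂ, ContDiff ℝ ((2 * n - 1 : ℕ) : ℕ∞) y →
      L p y x = (-1) ^ n * (iteratedDeriv (2 * n) y x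
        - ∑ l : Fin (2 * n), lowerCoeff p l x * iteratedDeriv l y x) := by
  have hd : ∀ᵐ x : ℝ, ∀ j : Fin n, ∀ i < (j : ℕ),
      DifferentiableAt ℝ (iteratedDeriv i (fun t => (p j t : ℂ))) x := by
    refine ae_all_iff.mpr fun j => ae_all_iff.mpr fun i => ?_
    by_cases hi : i < (j : ℕ)
    · filter_upwards [ae_differentiableAt_of_absolutelyContinuous fun a b =>
        absolutelyContinuousOnInterval_of_dist_le
          (f := iteratedDeriv i (fun t => (p j t : ℂ))) ((hp.hasACDerivs j i hi).2 a b)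
          fun x y => by
            rw [iteratedDeriv_ofReal_comp, Complex.dist_eq, ← Complex.ofReal_sub,
              Complex.norm_real]
            exact le_rfl] with x hx _ using hx
    · exact Eventually.of_forall fun x h => absurd h hi
  filter_upwards [hd] with x hx y hy
  have hy' : ∀ k ≤ 2 * n - 1, ContDiff ℝ ((2 * n - 1 - k : ℕ) : ℕ∞) (iteratedDeriv k y) := by
    intro k hk
    have : ContDiff ℝ (((2 * n - 1 - k) + k : ℕ) : ℕ∞) y := by
      rwa [Nat.sub_add_cancel hk]
    rw [iteratedDeriv_eq_iterate]
    exact ContDiff.iterate_deriv' (2 * n - 1 - k) k (by exact_mod_cast this)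
  rw [sum_lowerCoeff_mul p x fun l => iteratedDeriv l y x, L, mul_sub, mul_neg, sub_neg_eq_add,
    ← mul_assoc ((-1 : ℂ) ^ n) ((-1) ^ n), ← mul_pow]
  simp only [neg_mul, one_mul, neg_neg, one_pow]
  congr 1
  refine Finset.sum_congr rfl fun j _ => ?_
  have hj := j.2
  rw [iteratedDeriv_mul_of_differentiableAt (f := fun t => (p j t : ℂ))]
  · refine Finset.sum_congr rfl fun i hi => ?_
    have hi' := Finset.mem_range.mp hi
    rw [iteratedDeriv_ofReal_comp, iteratedDeriv_eq_iterate (n := (j : ℕ) - i),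
      iteratedDeriv_eq_iterate (n := (j : ℕ)) (f := y), ← Function.iterate_add_apply,
      ← iteratedDeriv_eq_iterate]
    congr 4
    omega
  · exact fun i hi => Complex.ofRealCLM.contDiff.comp (hp.hasACDerivs j i hi).1
  · exact hx j
  · exact (hy' j (by omega)).of_le (by exact_mod_cast (by omega : (j : ℕ) ≤ 2 * n - 1 - j))

end Reduction

/-! ### The equation `L y = μ y` as a companion system -/

section SpectralCoeff

variable {N : ℕ}

/-- The coefficients of `y^(N) = lam y + s ∑ r_l(t) y^(l)`. -/
noncomputable def spectralCoeff (r : Fin N → ℝ → ℂ) (lam s : ℂ) (l : Fin N) (t : ℝ) : ℂ :=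
  (if (l : ℕ) = 0 then lam else 0) + s * r l t

theorem locallyIntegrable_spectralCoeff {r : Fin N → ℝ → ℂ}
    (hr : ∀ l, LocallyIntegrable (r l) volume) (lam s : ℂ) (l : Fin N) :
    LocallyIntegrable (spectralCoeff r lam s l) volume :=
  (locallyIntegrable_const _).add ((hr l).smul s)

theorem sum_spectralCoeff_mul (r : Fin N → ℝ → ℂ) (lam s : ℂ) (t : ℝ) (Y : Fin N → ℂ)
    (hN : 0 < N) : ∑ l, spectralCoeff r lam s l t * Y l
      = lam * Y ⟨0, hN⟩ + s * ∑ l, r l t * Y l := by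
  simp only [spectralCoeff, add_mul, Finset.sum_add_distrib, Finset.mul_sum, mul_assoc]
  congr 1
  rw [Finset.sum_eq_single (⟨0, hN⟩ : Fin N)]
  · simp
  · intro l _ hl
    rw [if_neg (fun h => hl (Fin.ext h)), zero_mul]
  · simp

end SpectralCoeff

section Equivalence

variable {n : ℕ}

/-- The vector `(y, y', …, y^(2n-1))`. -/
noncomputable def jet (n : ℕ) (y : ℝ → ℂ) (x : ℝ) (i : Fin (2 * n)) : ℂ :=
  iteratedDeriv (i : ℕ) y x

/-- The coefficients of the equation `L y = μ y` solved for `y^(2n)`. -/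
noncomputable def equationCoeff (p : Fin n → ℝ → ℝ) (μ : ℂ) : Fin (2 * n) → ℝ → ℂ :=
  spectralCoeff (lowerCoeff p) ((-1) ^ n * μ) 1

theorem IsCoefficients.locallyIntegrable_equationCoeff {p : Fin n → ℝ → ℝ}
    (hp : IsCoefficients p) (μ : ℂ) (l : Fin (2 * n)) :
    LocallyIntegrable (equationCoeff p μ l) volume :=
  locallyIntegrable_spectralCoeff hp.locallyIntegrable_lowerCoeff _ _ l

theorem sum_equationCoeff_mul (p : Fin n → ℝ → ℝ) (μ : ℂ) (hn : 1 ≤ n) (t : ℝ)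
    (Y : Fin (2 * n) → ℂ) : ∑ l, equationCoeff p μ l t * Y l
      = (-1) ^ n * μ * Y ⟨0, by omega⟩ + ∑ l, lowerCoeff p l t * Y l := by
  rw [equationCoeff, sum_spectralCoeff_mul _ _ _ _ _ (by omega), one_mul]

theorem IsSolution.isCaratheodorySolution_jet (hn : 1 ≤ n) {p : Fin n → ℝ → ℝ}
    (hp : IsCoefficients p) {μ : ℂ} {y : ℝ → ℂ} (hy : IsSolution p μ y) :
    IsCaratheodorySolution (companionOp (equationCoeff p μ)) (jet n y) := by
  have hq := hp.locallyIntegrable_equationCoeff μ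
  have hcd : ContDiff ℝ ((2 * n - 1 : ℕ) : ℕ∞) y := (hy.1 (2 * n - 1) (by omega)).1
  have hcd' := contDiff_nat_iff_iteratedDeriv.mp hcd
  have hjet : Continuous (jet n y) := continuous_pi fun i => hcd'.1 i (by omega)
  refine isCaratheodorySolution_of_apply hq hjet fun i x => ?_
  by_cases hi : (i : ℕ) + 1 < 2 * n
  · simp only [companionOp_apply_of_lt _ _ _ hi, jet]
    rw [intervalIntegral.integral_eq_sub_of_hasDerivAt
      (f := iteratedDeriv (i : ℕ) y)]
    · ring
    · intro t _
      rw [iteratedDeriv_succ]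
      exact (hcd'.2 i (by omega) t).hasDerivAt
    · exact (hcd'.1 (i + 1) (by omega)).intervalIntegrable _ _
  · have hac := (hy.1 i i.2).2
    have hli : LocallyIntegrable (fun t => companionOp (equationCoeff p μ) t (jet n y t) i)
        volume := by
      have h := locallyIntegrable_clm_apply (locallyIntegrable_companionOp hq) hjet
      exact locallyIntegrableOn_univ.mp
        ((ContinuousLinearMap.proj (R := ℂ) (φ := fun _ : Fin (2 * n) => ℂ)
          i).locallyIntegrableOn_comp (locallyIntegrableOn_univ.mpr h))
    rw [integral_eq_sub_of_ae_hasDerivAt (hac 0 x) hli]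
    · simp [jet]
    · filter_upwards [ae_differentiableAt_of_absolutelyContinuous hac, hp.ae_L_eq, hy.2]
        with t h1 h2 h3
      rw [h2 y hcd] at h3
      have h4 : iteratedDeriv (2 * n) y t
          = companionOp (equationCoeff p μ) t (jet n y t) i := by
        rw [companionOp_apply_of_not_lt _ _ _ hi, sum_equationCoeff_mul p μ hn]
        simp only [jet, iteratedDeriv_zero]
        have h5 : ((-1 : ℂ) ^ n) * (-1) ^ n = 1 := by rw [← mul_pow]; simp
        linear_combination ((-1 : ℂ) ^ n) * h3
          - (iteratedDeriv (2 * n) y t - ∑ l, lowerCoeff p l t * iteratedDeriv (l : ℕ) y t) * h5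
      rw [← h4]
      have h6 : iteratedDeriv (2 * n) y = deriv (iteratedDeriv (i : ℕ) y) := by
        rw [← iteratedDeriv_succ]
        congr 1
        omega
      rw [h6]
      exact h1.hasDerivAt

theorem isSolution_of_isCaratheodorySolution (hn : 1 ≤ n) {p : Fin n → ℝ → ℝ}
    (hp : IsCoefficients p) {μ : ℂ} {Y : ℝ → Fin (2 * n) → ℂ}
    (hY : IsCaratheodorySolution (companionOp (equationCoeff p μ)) Y) :
    ∃ y, IsSolution p μ y ∧ jet n y = Y := by
  have hq := hp.locallyIntegrable_equationCoeff μ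
  have hcont : ∀ i, Continuous fun x => Y x i := continuous_pi_iff.mp hY.1
  have hderiv : ∀ (i : Fin (2 * n)) (h : (i : ℕ) + 1 < 2 * n) (x : ℝ),
      HasDerivAt (fun x => Y x i) (Y x ⟨i + 1, h⟩) x := by
    intro i h x
    have h1 : (fun x => Y x i) = fun x => Y 0 i + ∫ t in (0 : ℝ)..x, Y t ⟨i + 1, h⟩ := by
      funext x
      rw [hY.apply_eq hq i x]
      simp only [companionOp_apply_of_lt _ _ _ h]
    rw [h1]
    exact ((hcont _).integral_hasStrictDerivAt 0 x).hasDerivAt.const_add _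
  have h0 : 0 < 2 * n := by omega
  set y : ℝ → ℂ := fun x => Y x ⟨0, h0⟩ with hydef
  have hjet : ∀ (i : ℕ) (h : i < 2 * n), iteratedDeriv i y = fun x => Y x ⟨i, h⟩ := by
    intro i
    induction i with
    | zero => intro h; simp [hydef]
    | succ i ih =>
      intro h
      rw [iteratedDeriv_succ, ih (by omega)]
      exact funext fun x => (hderiv ⟨i, by omega⟩ h x).deriv
  have hli : ∀ i : Fin (2 * n),
      LocallyIntegrable (fun t => companionOp (equationCoeff p μ) t (Y t) i) volume := by
    intro i
    have h := locallyIntegrable_clm_apply (locallyIntegrable_companionOp hq) hY.1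
    exact locallyIntegrableOn_univ.mp
      ((ContinuousLinearMap.proj (R := ℂ) (φ := fun _ : Fin (2 * n) => ℂ)
        i).locallyIntegrableOn_comp (locallyIntegrableOn_univ.mpr h))
  have hcd : ∀ k < 2 * n, ContDiff ℝ k y := by
    intro k hk
    refine contDiff_nat_iff_iteratedDeriv.mpr ⟨fun m hm => ?_, fun m hm => ?_⟩
    · rw [hjet m (by omega)]; exact hcont _
    · rw [hjet m (by omega)]
      exact fun x => (hderiv ⟨m, by omega⟩ (by simp only; omega) x).differentiableAt
  refine ⟨y, ⟨fun i hi => ⟨hcd i hi, fun a b => ?_⟩, ?_⟩, ?_⟩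
  · rw [hjet i hi]
    refine absolutelyContinuousOnInterval_of_dist_le
      (absolutelyContinuousOnInterval_integral (hli ⟨i, hi⟩) 0 a b) fun x z => ?_
    rw [hY.apply_eq hq ⟨i, hi⟩ x, hY.apply_eq hq ⟨i, hi⟩ z, dist_add_left]
  · have hlast : 2 * n - 1 < 2 * n := by omega
    filter_upwards [hp.ae_L_eq,
      _root_.LocallyIntegrable.ae_hasDerivAt_integral (hli ⟨2 * n - 1, hlast⟩)] with x h1 h2
    rw [h1 y (hcd _ hlast)]
    have h3 : iteratedDeriv (2 * n) y x
        = companionOp (equationCoeff p μ) x (Y x) ⟨2 * n - 1, hlast⟩ := by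
      obtain ⟨m, hm⟩ : ∃ m, 2 * n = m + 1 := ⟨2 * n - 1, by omega⟩
      have hm' : m = 2 * n - 1 := by omega
      have h4 : iteratedDeriv m y = fun x => Y 0 ⟨2 * n - 1, hlast⟩
          + ∫ t in (0 : ℝ)..x, companionOp (equationCoeff p μ) t (Y t) ⟨2 * n - 1, hlast⟩ := by
        subst hm'
        rw [hjet _ hlast]
        exact funext fun x => hY.apply_eq hq _ x
      have h5 : iteratedDeriv (2 * n) y = deriv (iteratedDeriv m y) := by
        rw [hm, iteratedDeriv_succ]
      rw [h5, h4]
      exact ((h2 0).const_add _).deriv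
    rw [h3, companionOp_apply_of_not_lt _ _ _ (by simp only; omega),
      sum_equationCoeff_mul p μ hn]
    have h4 : ∀ l : Fin (2 * n), iteratedDeriv (l : ℕ) y x = Y x l := fun l =>
      congrFun (hjet l l.2) x
    simp only [h4]
    have h5 : ((-1 : ℂ) ^ n) * (-1) ^ n = 1 := by rw [← mul_pow]; simp
    simp only [hydef]
    linear_combination μ * Y x ⟨0, h0⟩ * h5
  · funext x i
    exact congrFun (hjet i i.2) x

/-- The monodromy matrix in terms of the companion system. Existence of the normalized solutions
makes the choice in the definition of `u` meaningful, and uniqueness identifies it. -/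
theorem U_eq_solutionMatrix (hn : 1 ≤ n) {p : Fin n → ℝ → ℝ} (hp : IsCoefficients p) (μ : ℂ) :
    U p μ = solutionMatrix (equationCoeff p μ) Real.pi := by
  have hq := hp.locallyIntegrable_equationCoeff μ
  have hA := locallyIntegrable_companionOp hq
  ext k j
  have hS := isCaratheodorySolution_caratheodorySolution hA (Pi.single k (1 : ℂ))
  obtain ⟨y, hy, hyS⟩ := isSolution_of_isCaratheodorySolution hn hp hS
  have hu : IsSolution p μ (u p k μ) ∧
      ∀ j : Fin (2 * n), iteratedDeriv (j : ℕ) (u p k μ) 0 = if k = j then 1 else 0 := by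
    refine Classical.epsilon_spec (p := fun y : ℝ → ℂ => IsSolution p μ y ∧
      ∀ j : Fin (2 * n), iteratedDeriv (j : ℕ) y 0 = if k = j then 1 else 0) ⟨y, hy, fun j => ?_⟩
    have h := congrFun (congrFun hyS 0) j
    rw [caratheodorySolution_zero] at h
    rw [← jet, h, Pi.single_apply]
    simp only [eq_comm]
  have h := (hu.1.isCaratheodorySolution_jet hn hp).eq_of_eq_zero hA hS (by
    rw [caratheodorySolution_zero]
    funext j
    rw [jet, hu.2 j, Pi.single_apply]
    simp only [eq_comm])
  exact congrFun (congrFun h Real.pi) j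

end Equivalence

/-! ### An a priori bound for scalar quasi-periodic equations -/

section Scalar

/-- An a priori bound for scalar quasi-periodic solutions: if `g' = a g + F` and
`g(π) = e^{κπ} g(0)`, then `e^{-κx} g(x)` is controlled by the `L¹` norm of `e^{-κx} F(x)` with a
constant depending only on the relative distance of `e^{aπ}` and `e^{κπ}`. -/
theorem norm_exp_mul_le_of_quasiperiodic {a κ : ℂ} {g F : ℝ → ℂ} {h : ℝ → ℝ} {c : ℝ} (hc : 0 < c)
    (hg : Continuous g) (hF : LocallyIntegrable F volume)
    (heq : ∀ x, g x = g 0 + ∫ t in (0 : ℝ)..x, (a * g t + F t))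
    (hper : g Real.pi = Complex.exp (κ * Real.pi) * g 0) (hh : LocallyIntegrable h volume)
    (hFh : ∀ t ∈ Icc 0 Real.pi, ‖Complex.exp (-κ * t) * F t‖ ≤ h t)
    (hsep : c * max ‖Complex.exp (a * Real.pi)‖ ‖Complex.exp (κ * Real.pi)‖
      ≤ ‖Complex.exp (a * Real.pi) - Complex.exp (κ * Real.pi)‖) :
    ∀ x ∈ Icc 0 Real.pi,
      ‖Complex.exp (-κ * x) * g x‖ ≤ (1 + 1 / c) * ∫ t in (0 : ℝ)..Real.pi, h t := by
  set m := ∫ t in (0 : ℝ)..Real.pi, h t with hm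
  have hpi := Real.pi_pos.le
  have hh0 : ∀ t ∈ Icc 0 Real.pi, 0 ≤ h t := fun t ht => (norm_nonneg _).trans (hFh t ht)
  have hhI := intervalIntegrable_of_locallyIntegrable hh
  set b := a - κ with hb
  set V : ℝ → ℂ := fun x => Complex.exp (-κ * x) * g x with hV
  have hexp : ∀ d : ℂ, ContDiff ℝ ⊤ fun t : ℝ => Complex.exp (d * t) := fun d =>
    Complex.contDiff_exp.comp (contDiff_const.mul Complex.ofRealCLM.contDiff)
  have hexpd : ∀ (d : ℂ) (x : ℝ),
      HasDerivAt (fun t : ℝ => Complex.exp (d * t)) (d * Complex.exp (d * x)) x := by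
    intro d x
    have h1 : HasDerivAt (fun t : ℝ => d * (t : ℂ)) (d * 1) x :=
      (Complex.ofRealCLM.hasDerivAt (x := x)).const_mul d
    convert! h1.cexp using 1
    ring
  -- variation of constants
  have hli : LocallyIntegrable (fun t => a * g t + F t) volume :=
    (continuous_const.mul hg).locallyIntegrable.add hF
  have hvar : ∀ x y : ℝ, Complex.exp (-a * x) * g x - Complex.exp (-a * y) * g y
      = ∫ t in y..x, Complex.exp (-a * t) * F t := by
    intro x y
    have hac : AbsolutelyContinuousOnInterval g y x := by
      refine absolutelyContinuousOnInterval_of_dist_le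
        (absolutelyContinuousOnInterval_integral hli 0 y x) fun s t => ?_
      rw [heq s, heq t, dist_add_left]
    have hac2 : AbsolutelyContinuousOnInterval (fun t : ℝ => Complex.exp (-a * t)) y x :=
      (((hexp (-a)).of_le (by exact le_top)).contDiffOn).absolutelyContinuousOnInterval
    rw [integral_eq_sub_of_ae_hasDerivAt (hac2.smul hac)]
    · rfl
    · exact hF.continuous_mul (hexp (-a)).continuous
    · filter_upwards [_root_.LocallyIntegrable.ae_hasDerivAt_integral hli] with t ht
      have h1 : HasDerivAt g (a * g t + F t) t := by
        rw [funext heq]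
        simpa only [← heq t] using (ht 0).const_add (g 0)
      convert! (hexpd (-a) t).mul h1 using 1
      ring
  have hvarV : ∀ x y : ℝ, V x - Complex.exp (b * (x - y)) * V y
      = ∫ t in y..x, Complex.exp (b * (x - t)) * (Complex.exp (-κ * t) * F t) := by
    intro x y
    have h1 : ∀ t : ℝ, Complex.exp (b * (x - t)) * (Complex.exp (-κ * t) * F t)
        = Complex.exp (b * x) * (Complex.exp (-a * t) * F t) := by
      intro t
      rw [← mul_assoc, ← mul_assoc, ← Complex.exp_add, ← Complex.exp_add]
      congr 2
      rw [hb]; ring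
    simp only [h1, hV]
    have e1 : Complex.exp (-κ * x) = Complex.exp (b * x) * Complex.exp (-a * x) := by
      rw [← Complex.exp_add, hb]; ring_nf
    have e2 : Complex.exp (b * (x - y)) * Complex.exp (-κ * y)
        = Complex.exp (b * x) * Complex.exp (-a * y) := by
      rw [← Complex.exp_add, ← Complex.exp_add, hb]; ring_nf
    rw [intervalIntegral.integral_const_mul, ← hvar]
    linear_combination g x * e1 - g y * e2
  have hper' : V Real.pi = V 0 := by
    simp only [hV, hper, ← mul_assoc, ← Complex.exp_add]
    simp
  have hbound : ∀ x ∈ Icc 0 Real.pi, ∀ y ∈ Icc 0 Real.pi, (∀ t ∈ uIcc y x, b.re * (x - t) ≤ 0) →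
      ‖V x - Complex.exp (b * (x - y)) * V y‖ ≤ m := by
    intro x hx y hy hre
    have hsub : uIcc y x ⊆ Icc 0 Real.pi := by
      rw [← uIcc_of_le hpi] at hx hy ⊢
      exact uIcc_subset_uIcc hy hx
    rw [hvarV]
    calc _ ≤ |∫ t in y..x, h t| := by
            refine intervalIntegral.norm_integral_le_abs_of_norm_le ?_ (hhI y x)
            filter_upwards [ae_restrict_mem measurableSet_uIoc] with t ht
            have ht' := uIoc_subset_uIcc ht
            rw [norm_mul]
            have h1 : ‖Complex.exp (b * (x - t))‖ ≤ 1 := by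
              rw [Complex.norm_exp, ← Complex.ofReal_sub, Complex.re_mul_ofReal]
              exact Real.exp_le_one_iff.mpr (hre t ht')
            calc _ ≤ 1 * ‖Complex.exp (-κ * t) * F t‖ := by gcongr
              _ ≤ h t := by rw [one_mul]; exact hFh t (hsub ht')
      _ ≤ |m| := by
            refine intervalIntegral.abs_integral_mono_interval ?_ ?_ (hhI _ _)
            · rw [uIoc_of_le hpi]
              rcases le_total y x with hyx | hyx
              · rw [uIoc_of_le hyx]; exact Ioc_subset_Ioc hy.1 hx.2
              · rw [uIoc_of_ge hyx]; exact Ioc_subset_Ioc hx.1 hy.2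
            · filter_upwards [ae_restrict_mem measurableSet_uIoc] with t ht
              rw [uIoc_of_le hpi] at ht
              exact hh0 t ⟨ht.1.le, ht.2⟩
      _ = m := abs_of_nonneg (intervalIntegral.integral_nonneg hpi hh0)
  have hm0 : 0 ≤ m := intervalIntegral.integral_nonneg hpi hh0
  have h0mem : (0 : ℝ) ∈ Icc 0 Real.pi := ⟨le_rfl, hpi⟩
  have hpimem : Real.pi ∈ Icc 0 Real.pi := ⟨hpi, le_rfl⟩
  have hfinish : ∀ (x : ℝ) (v w : ℂ), ‖w‖ ≤ 1 → ‖V x - w * v‖ ≤ m → c * ‖v‖ ≤ m →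
      ‖V x‖ ≤ (1 + 1 / c) * m := by
    intro x v w hw h1 h2
    have h3 : ‖v‖ ≤ m / c := by rw [le_div_iff₀ hc]; linarith
    calc ‖V x‖ = ‖(V x - w * v) + w * v‖ := by ring_nf
      _ ≤ m + 1 * (m / c) := by
          refine (norm_add_le _ _).trans (add_le_add h1 ?_)
          rw [norm_mul]
          gcongr
      _ = (1 + 1 / c) * m := by ring
  intro x hx
  change ‖V x‖ ≤ _
  -- integrate from the end of the period from which the propagator `e^{b(x-y)}` does not grow
  rcases le_total b.re 0 with hbr | hbr
  · refine hfinish x (V 0) (Complex.exp (b * (x - (0 : ℝ)))) ?_ (hbound x hx 0 h0mem ?_) ?_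
    · rw [Complex.norm_exp, ← Complex.ofReal_sub, Complex.re_mul_ofReal, Real.exp_le_one_iff]
      exact mul_nonpos_of_nonpos_of_nonneg hbr (by simpa using hx.1)
    · intro t ht
      rw [uIcc_of_le hx.1] at ht
      exact mul_nonpos_of_nonpos_of_nonneg hbr (by linarith [ht.2])
    · have h1 := hbound Real.pi hpimem 0 h0mem (by
        intro t ht
        rw [uIcc_of_le hpi] at ht
        exact mul_nonpos_of_nonpos_of_nonneg hbr (by linarith [ht.2]))
      rw [hper', ← one_sub_mul, norm_mul] at h1
      refine le_trans ?_ h1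
      gcongr
      have h2 : Complex.exp (a * Real.pi) - Complex.exp (κ * Real.pi)
          = -(Complex.exp (κ * Real.pi) * (1 - Complex.exp (b * (Real.pi - (0 : ℝ))))) := by
        rw [mul_sub, ← Complex.exp_add, hb]
        simp only [Complex.ofReal_zero, sub_zero]
        ring_nf
      rw [h2, norm_neg, norm_mul] at hsep
      have h3 : 0 < ‖Complex.exp (κ * Real.pi)‖ := norm_pos_iff.mpr (Complex.exp_ne_zero _)
      have h4 := (mul_le_mul_of_nonneg_left (le_max_right ‖Complex.exp (a * Real.pi)‖
        ‖Complex.exp (κ * Real.pi)‖) hc.le).trans hsep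
      rw [mul_comm c] at h4
      exact le_of_mul_le_mul_left h4 h3
  · refine hfinish x (V Real.pi) (Complex.exp (b * (x - Real.pi))) ?_
      (hbound x hx Real.pi hpimem ?_) ?_
    · rw [Complex.norm_exp, ← Complex.ofReal_sub, Complex.re_mul_ofReal, Real.exp_le_one_iff]
      exact mul_nonpos_of_nonneg_of_nonpos hbr (by linarith [hx.2])
    · intro t ht
      rw [uIcc_of_ge hx.2] at ht
      exact mul_nonpos_of_nonneg_of_nonpos hbr (by linarith [ht.1])
    · have h1 := hbound 0 h0mem Real.pi hpimem (by
        intro t ht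
        rw [uIcc_of_ge hpi] at ht
        exact mul_nonpos_of_nonneg_of_nonpos hbr (by linarith [ht.1]))
      rw [← hper', ← one_sub_mul, norm_mul] at h1
      refine le_trans ?_ h1
      gcongr
      have h2 : Complex.exp (a * Real.pi) - Complex.exp (κ * Real.pi)
          = Complex.exp (a * Real.pi) * (1 - Complex.exp (b * ((0 : ℝ) - Real.pi))) := by
        rw [mul_sub, ← Complex.exp_add, hb]
        simp only [Complex.ofReal_zero, zero_sub]
        ring_nf
      rw [h2, norm_mul] at hsep
      have h3 : 0 < ‖Complex.exp (a * Real.pi)‖ := norm_pos_iff.mpr (Complex.exp_ne_zero _)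
      have h4 := (mul_le_mul_of_nonneg_left (le_max_left ‖Complex.exp (a * Real.pi)‖
        ‖Complex.exp (κ * Real.pi)‖) hc.le).trans hsep
      rw [mul_comm c] at h4
      exact le_of_mul_le_mul_left h4 h3

end Scalar

/-! ### Numbers which are not multipliers -/

section Multipliers

variable {N : ℕ}

/-- The functional `W_a(Y) = ∑_j a^(N-1-j) Y_j`, which comes from the factorization
`D^N - a^N = (D - a) ∑_j a^(N-1-j) D^j`. -/
noncomputable def factorFunctional (N : ℕ) (a : ℂ) : (Fin N → ℂ) →L[ℂ] ℂ :=
  ∑ j : Fin N, a ^ (N - 1 - (j : ℕ)) • ContinuousLinearMap.proj j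

theorem factorFunctional_apply (a : ℂ) (Y : Fin N → ℂ) :
    factorFunctional N a Y = ∑ j : Fin N, a ^ (N - 1 - (j : ℕ)) * Y j := by
  simp [factorFunctional]

theorem factorFunctional_companionOp (r : Fin N → ℝ → ℂ) (a s : ℂ) (t : ℝ) (Y : Fin N → ℂ) :
    factorFunctional N a (companionOp (spectralCoeff r (a ^ N) s) t Y)
      = a * factorFunctional N a Y + s * ∑ l, r l t * Y l := by
  cases N with
  | zero => simp [factorFunctional]
  | succ m =>
    simp only [factorFunctional_apply]
    rw [Fin.sum_univ_castSucc, companionOp_apply_of_not_lt _ _ _ (by simp),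
      sum_spectralCoeff_mul _ _ _ _ _ (Nat.succ_pos m), Fin.sum_univ_succ
        (f := fun j : Fin (m + 1) => a ^ (m + 1 - 1 - (j : ℕ)) * Y j), mul_add]
    have h : ∀ i : Fin m, a ^ (m + 1 - 1 - ((Fin.castSucc i : Fin (m + 1)) : ℕ))
        * companionOp (spectralCoeff r (a ^ (m + 1)) s) t Y (Fin.castSucc i)
        = a * (a ^ (m + 1 - 1 - ((Fin.succ i : Fin (m + 1)) : ℕ)) * Y i.succ) := by
      intro i
      rw [companionOp_apply_of_lt _ _ _ (by simp)]
      have : m + 1 - 1 - ((Fin.castSucc i : Fin (m + 1)) : ℕ)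
          = (m + 1 - 1 - ((Fin.succ i : Fin (m + 1)) : ℕ)) + 1 := by
        have := i.2
        simp only [Fin.val_castSucc, Fin.val_succ]
        omega
      rw [this, pow_succ]
      simp only [Fin.val_castSucc]
      rw [show (⟨(i : ℕ) + 1, by omega⟩ : Fin (m + 1)) = i.succ from rfl]
      ring
    rw [Finset.sum_congr rfl fun i _ => h i, ← Finset.mul_sum]
    simp only [Fin.val_last, Nat.add_sub_cancel, Nat.sub_self, pow_zero, one_mul, Fin.val_zero,
      Nat.sub_zero, Fin.mk_zero]
    ring

/-- Fourier inversion for the functionals `W_{ωz}`, `ω` running over the roots of unity. -/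
theorem sum_factorFunctional {η : ℂ} (hη : IsPrimitiveRoot η N) (z : ℂ) (Y : Fin N → ℂ)
    (m : Fin N) :
    ∑ k ∈ Finset.range N, (η ^ k) ^ ((m : ℕ) + 1) * factorFunctional N (η ^ k * z) Y
      = N * (z ^ (N - 1 - (m : ℕ)) * Y m) := by
  simp only [factorFunctional_apply, Finset.mul_sum]
  rw [Finset.sum_comm, Finset.sum_eq_single m]
  · have h : ∀ k ∈ Finset.range N, (η ^ k) ^ ((m : ℕ) + 1)
        * ((η ^ k * z) ^ (N - 1 - (m : ℕ)) * Y m) = z ^ (N - 1 - (m : ℕ)) * Y m := by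
      intro k _
      have h1 : (η ^ k) ^ ((m : ℕ) + 1) * (η ^ k) ^ (N - 1 - (m : ℕ)) = 1 := by
        rw [← pow_add, show (m : ℕ) + 1 + (N - 1 - m) = N by omega, ← pow_mul, mul_comm, pow_mul,
          hη.pow_eq_one, one_pow]
      rw [mul_pow]
      linear_combination z ^ (N - 1 - (m : ℕ)) * Y m * h1
    rw [Finset.sum_congr rfl h]
    simp
  · intro j _ hj
    have h : ∀ k ∈ Finset.range N, (η ^ k) ^ ((m : ℕ) + 1)
        * ((η ^ k * z) ^ (N - 1 - (j : ℕ)) * Y j)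
        = (η ^ ((m : ℕ) + (N - j))) ^ k * (z ^ (N - 1 - (j : ℕ)) * Y j) := by
      intro k _
      have h1 : (η ^ k) ^ ((m : ℕ) + 1) * (η ^ k) ^ (N - 1 - (j : ℕ))
          = (η ^ ((m : ℕ) + (N - j))) ^ k := by
        rw [← pow_add, show (m : ℕ) + 1 + (N - 1 - j) = m + (N - j) by omega, ← pow_mul,
          mul_comm, pow_mul]
      rw [mul_pow]
      linear_combination z ^ (N - 1 - (j : ℕ)) * Y j * h1
    rw [Finset.sum_congr rfl h, ← Finset.sum_mul]
    have hne : η ^ ((m : ℕ) + (N - j)) ≠ 1 := by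
      intro h1
      have h2 := hη.dvd_of_pow_eq_one _ h1
      obtain ⟨d, hd⟩ := h2
      have hm := m.2
      have hj2 := j.2
      have hjm : (j : ℕ) ≠ m := fun h => hj (Fin.ext h)
      rcases Nat.lt_or_ge d 1 with h3 | h3
      · have : d = 0 := by omega
        subst this; omega
      · rcases Nat.lt_or_ge d 2 with h4 | h4
        · have : d = 1 := by omega
          subst this; omega
        · have : N * 2 ≤ N * d := Nat.mul_le_mul_left _ h4
          omega
    have hz : ∑ k ∈ Finset.range N, (η ^ ((m : ℕ) + (N - j))) ^ k = 0 := by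
      have h1 := mul_neg_geom_sum (η ^ ((m : ℕ) + (N - j))) N
      rw [← pow_mul, mul_comm _ N, pow_mul, hη.pow_eq_one, one_pow, sub_self] at h1
      exact (mul_eq_zero.mp h1).resolve_left (sub_ne_zero.mpr hne.symm)
    rw [hz, zero_mul]
  · simp

theorem norm_le_of_factorFunctional_le {η : ℂ} (hη : IsPrimitiveRoot η N) {z : ℂ} {Y : Fin N → ℂ}
    {B : ℝ} (h : ∀ k < N, ‖factorFunctional N (η ^ k * z) Y‖ ≤ B) (m : Fin N) :
    ‖z‖ ^ (N - 1 - (m : ℕ)) * ‖Y m‖ ≤ B := by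
  have hN : 0 < N := m.pos
  have h1 : ‖η‖ = 1 := hη.norm'_eq_one hN.ne'
  have h2 : ‖(N : ℂ) * (z ^ (N - 1 - (m : ℕ)) * Y m)‖ ≤ ∑ k ∈ Finset.range N, B := by
    rw [← sum_factorFunctional hη]
    refine norm_sum_le_of_le _ fun k hk => ?_
    rw [norm_mul, norm_pow, norm_pow, h1, one_pow, one_pow, one_mul]
    exact h k (Finset.mem_range.mp hk)
  rw [norm_mul, Complex.norm_natCast, norm_mul, norm_pow, Finset.sum_const, Finset.card_range,
    nsmul_eq_mul] at h2
  exact le_of_mul_le_mul_left h2 (by exact_mod_cast hN)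

/-- If `ρ` has a positive relative distance `c` to all the numbers `e^{πωz}` and `|z|` is large
in comparison with `1 / c` and with the lower order coefficients, then no nonzero solution
satisfies `Y(π) = ρ Y(0)`. -/
theorem IsCaratheodorySolution.eq_zero_of_separated {r : Fin N → ℝ → ℂ}
    (hr : ∀ l, LocallyIntegrable (r l) volume)
    (hlast : ∀ (l : Fin N) (t : ℝ), ¬ (l : ℕ) + 1 < N → r l t = 0) {η : ℂ}
    (hη : IsPrimitiveRoot η N) {z s ρ : ℂ} {c : ℝ} (hs : ‖s‖ ≤ 1) (hρ : ρ ≠ 0) (hc : 0 < c)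
    (hz1 : 1 ≤ ‖z‖)
    (hz : (1 + 1 / c) * ∫ t in (0 : ℝ)..Real.pi, ∑ l, ‖r l t‖ < ‖z‖)
    (hsep : ∀ k < N, c * max ‖Complex.exp (η ^ k * z * Real.pi)‖ ‖ρ‖
      ≤ ‖Complex.exp (η ^ k * z * Real.pi) - ρ‖)
    {Y : ℝ → Fin N → ℂ} (hY : IsCaratheodorySolution (companionOp (spectralCoeff r (z ^ N) s)) Y)
    (hper : Y Real.pi = ρ • Y 0) : Y 0 = 0 := by
  have hpi := Real.pi_pos.le
  have hz0 : 0 < ‖z‖ := by linarith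
  rcases Nat.eq_zero_or_pos N with rfl | hN
  · exact Subsingleton.elim _ _
  -- the Floquet exponent: `e^{-κx} Y(x)` is periodic
  obtain ⟨κ, hκ⟩ : ∃ κ : ℂ, Complex.exp (κ * Real.pi) = ρ := by
    refine ⟨Complex.log ρ / Real.pi, ?_⟩
    rw [div_mul_cancel₀ _ (by exact_mod_cast Real.pi_pos.ne'), Complex.exp_log hρ]
  set W : ℕ → ℝ → ℂ := fun k x => factorFunctional N (η ^ k * z) (Y x) with hW
  have hWc : ∀ k, Continuous (W k) := fun k =>
    (factorFunctional N (η ^ k * z)).continuous.comp hY.1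
  have hYc : ∀ l, Continuous fun t => Y t l := continuous_pi_iff.mp hY.1
  set F : ℝ → ℂ := fun t => s * ∑ l, r l t * Y t l with hFdef
  have hF : LocallyIntegrable F volume :=
    (locallyIntegrable_finsetSum _ fun l _ => (hr l).mul_continuous (hYc l)).smul s
  have hpow : ∀ k, (η ^ k * z) ^ N = z ^ N := fun k => by
    rw [mul_pow, ← pow_mul, mul_comm k, pow_mul, hη.pow_eq_one, one_pow, one_mul]
  have hWeq : ∀ k x, W k x = W k 0 + ∫ t in (0 : ℝ)..x, (η ^ k * z * W k t + F t) := by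
    intro k x
    have hI := intervalIntegrable_of_locallyIntegrable (locallyIntegrable_clm_apply
      (locallyIntegrable_companionOp (locallyIntegrable_spectralCoeff hr (z ^ N) s)) hY.1) 0 x
    have h1 := (factorFunctional N (η ^ k * z)).intervalIntegral_comp_comm hI
    have h2 := congrArg (factorFunctional N (η ^ k * z)) (hY.2 x)
    rw [map_add, ← h1] at h2
    simp only [hW]
    rw [h2]
    congr 2
    funext t
    rw [← hpow k, factorFunctional_companionOp]
  -- the maximum over `[0, π]` and over all roots of unity of the periodic functions
  -- `e^{-κx} W(x)`; the a priori bound for the maximal one contradicts its positivity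
  have hmax : ∀ k : Fin N, ∃ x ∈ Icc 0 Real.pi, ∀ t ∈ Icc 0 Real.pi,
      ‖Complex.exp (-κ * t) * W k t‖ ≤ ‖Complex.exp (-κ * x) * W k x‖ := by
    intro k
    have hcont : Continuous fun t : ℝ => ‖Complex.exp (-κ * t) * W k t‖ :=
      ((Complex.continuous_exp.comp (continuous_const.mul Complex.continuous_ofReal)).mul
        (hWc k)).norm
    obtain ⟨x, hx, hmx⟩ := isCompact_Icc.exists_isMaxOn (nonempty_Icc.mpr hpi) hcont.continuousOn
    exact ⟨x, hx, fun t ht => hmx ht⟩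
  choose X hX hXmax using hmax
  have : Nonempty (Fin N) := ⟨⟨0, hN⟩⟩
  obtain ⟨k₀, hk₀⟩ := Finite.exists_max fun k : Fin N =>
    ‖Complex.exp (-κ * X k) * W k (X k)‖
  set K := ‖Complex.exp (-κ * X k₀) * W k₀ (X k₀)‖ with hK
  have hWK : ∀ k < N, ∀ t ∈ Icc 0 Real.pi,
      ‖factorFunctional N (η ^ k * z) (Complex.exp (-κ * t) • Y t)‖ ≤ K := by
    intro k hk t ht
    rw [map_smul, smul_eq_mul]
    exact (hXmax ⟨k, hk⟩ t ht).trans (hk₀ ⟨k, hk⟩)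
  have hYK : ∀ t ∈ Icc 0 Real.pi, ∀ l : Fin N, (l : ℕ) + 1 < N →
      ‖Complex.exp (-κ * t) * Y t l‖ ≤ K / ‖z‖ := by
    intro t ht l hl
    have h1 := norm_le_of_factorFunctional_le hη (fun k hk => hWK k hk t ht) l
    rw [le_div_iff₀ hz0, mul_comm]
    refine le_trans ?_ h1
    simp only [Pi.smul_apply, smul_eq_mul]
    gcongr
    exact le_self_pow₀ hz1 (by omega)
  set q : ℝ → ℝ := fun t => ∑ l, ‖r l t‖ with hq
  have hqli : LocallyIntegrable q volume :=
    locallyIntegrable_finsetSum _ fun l _ => locallyIntegrable_norm (hr l)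
  have hFb : ∀ t ∈ Icc 0 Real.pi, ‖Complex.exp (-κ * t) * F t‖ ≤ q t * (K / ‖z‖) := by
    intro t ht
    have h1 : Complex.exp (-κ * t) * F t = s * ∑ l, r l t * (Complex.exp (-κ * t) * Y t l) := by
      simp only [hFdef, Finset.mul_sum]
      exact Finset.sum_congr rfl fun l _ => by ring
    rw [h1, norm_mul, hq, Finset.sum_mul]
    calc _ ≤ 1 * ‖∑ l, r l t * (Complex.exp (-κ * t) * Y t l)‖ := by gcongr
      _ ≤ _ := by
        rw [one_mul]
        refine norm_sum_le_of_le _ fun l _ => ?_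
        by_cases hl : (l : ℕ) + 1 < N
        · rw [norm_mul]
          gcongr
          exact hYK t ht l hl
        · rw [hlast l t hl]; simp
  have hKle : K ≤ (1 + 1 / c) * ∫ t in (0 : ℝ)..Real.pi, q t * (K / ‖z‖) := by
    refine norm_exp_mul_le_of_quasiperiodic hc (hWc k₀) hF (hWeq k₀) ?_
      (hqli.mul_continuous continuous_const) hFb ?_ (X k₀) (hX k₀)
    · simp only [hW]
      rw [hper, map_smul, smul_eq_mul, hκ]
    · rw [hκ]; exact hsep k₀ k₀.2
  rw [intervalIntegral.integral_mul_const] at hKle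
  have hK0 : K ≤ 0 := by
    by_contra hpos
    push Not at hpos
    have h1 : K * ‖z‖ ≤ ((1 + 1 / c) * ∫ t in (0 : ℝ)..Real.pi, q t) * K := by
      calc K * ‖z‖ ≤ ((1 + 1 / c) * ((∫ t in (0 : ℝ)..Real.pi, q t) * (K / ‖z‖))) * ‖z‖ := by
            gcongr
        _ = _ := by field_simp
    have h2 : ((1 + 1 / c) * ∫ t in (0 : ℝ)..Real.pi, q t) * K < ‖z‖ * K := by gcongr
    linarith
  funext m
  have h1 := norm_le_of_factorFunctional_le hη (fun k hk => hWK k hk 0 ⟨le_rfl, hpi⟩) m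
  have h2 : 0 < ‖z‖ ^ (N - 1 - (m : ℕ)) := by positivity
  have h3 : ‖(Complex.exp (-κ * (0 : ℝ)) • Y 0) m‖ ≤ 0 := by
    by_contra h
    push Not at h
    have := mul_pos h2 h
    linarith
  simpa using h3

/-- Row vectors are used because the rows of the solution matrix are the solutions. -/
theorem isRoot_charpoly_iff {ι : Type*} [Fintype ι] [DecidableEq ι] (M : Matrix ι ι ℂ) (ρ : ℂ) :
    M.charpoly.IsRoot ρ ↔ ∃ v ≠ 0, Matrix.vecMul v M = ρ • v := by
  rw [Polynomial.IsRoot, Matrix.eval_charpoly, ← Matrix.exists_vecMul_eq_zero_iff]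
  refine exists_congr fun v => and_congr_right fun _ => ?_
  rw [Matrix.vecMul_sub, sub_eq_zero, eq_comm]
  simp [Matrix.scalar_apply, ← Matrix.smul_one_eq_diagonal, Matrix.vecMul_smul]

theorem not_isRoot_charpoly_of_separated {r : Fin N → ℝ → ℂ}
    (hr : ∀ l, LocallyIntegrable (r l) volume)
    (hlast : ∀ (l : Fin N) (t : ℝ), ¬ (l : ℕ) + 1 < N → r l t = 0) {η : ℂ}
    (hη : IsPrimitiveRoot η N) {z s ρ : ℂ} {c : ℝ} (hs : ‖s‖ ≤ 1) (hρ : ρ ≠ 0) (hc : 0 < c)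
    (hz1 : 1 ≤ ‖z‖)
    (hz : (1 + 1 / c) * ∫ t in (0 : ℝ)..Real.pi, ∑ l, ‖r l t‖ < ‖z‖)
    (hsep : ∀ k < N, c * max ‖Complex.exp (η ^ k * z * Real.pi)‖ ‖ρ‖
      ≤ ‖Complex.exp (η ^ k * z * Real.pi) - ρ‖) :
    ¬ (solutionMatrix (spectralCoeff r (z ^ N) s) Real.pi).charpoly.IsRoot ρ := by
  rw [isRoot_charpoly_iff]
  rintro ⟨v, hv, hvM⟩
  have hq := locallyIntegrable_spectralCoeff hr (z ^ N) s
  have hY := isCaratheodorySolution_caratheodorySolution (locallyIntegrable_companionOp hq) v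
  have h1 := hY.eq_vecMul_solutionMatrix hq Real.pi
  have h2 := hY.eq_zero_of_separated hr hlast hη hs hρ hc hz1 hz hsep (by
    rw [h1, caratheodorySolution_zero, hvM])
  rw [caratheodorySolution_zero] at h2
  exact hv h2

/-- The multipliers of the unperturbed equation `y^(N) = a^N y`. -/
theorem isRoot_charpoly_unperturbed (hN : 0 < N) {r : Fin N → ℝ → ℂ}
    (hr : ∀ l, LocallyIntegrable (r l) volume) (a : ℂ) :
    (solutionMatrix (spectralCoeff r (a ^ N) 0) Real.pi).charpoly.IsRoot
      (Complex.exp (a * Real.pi)) := by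
  rw [isRoot_charpoly_iff]
  have hq := locallyIntegrable_spectralCoeff hr (a ^ N) 0
  set Y : ℝ → Fin N → ℂ := fun x i => a ^ (i : ℕ) * Complex.exp (a * x) with hYdef
  have hexpc : Continuous fun t : ℝ => Complex.exp (a * t) :=
    Complex.continuous_exp.comp (continuous_const.mul Complex.continuous_ofReal)
  have hexpd : ∀ x : ℝ,
      HasDerivAt (fun t : ℝ => Complex.exp (a * t)) (a * Complex.exp (a * x)) x := by
    intro x
    have h1 : HasDerivAt (fun t : ℝ => a * (t : ℂ)) (a * 1) x :=
      (Complex.ofRealCLM.hasDerivAt (x := x)).const_mul a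
    convert! h1.cexp using 1
    ring
  have hY : IsCaratheodorySolution (companionOp (spectralCoeff r (a ^ N) 0)) Y := by
    refine isCaratheodorySolution_of_apply hq (continuous_pi fun i => continuous_const.mul hexpc)
      fun i x => ?_
    have h : ∀ t, companionOp (spectralCoeff r (a ^ N) 0) t (Y t) i
        = a ^ (i : ℕ) * (a * Complex.exp (a * t)) := by
      intro t
      by_cases hi : (i : ℕ) + 1 < N
      · rw [companionOp_apply_of_lt _ _ _ hi]
        simp only [hYdef]
        ring
      · rw [companionOp_apply_of_not_lt _ _ _ hi, sum_spectralCoeff_mul _ _ _ _ _ hN]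
        have : N = i + 1 := by omega
        have h3 : a ^ N = a ^ (i : ℕ) * a := by
          rw [← pow_succ]
          congr 1
        simp only [hYdef, zero_mul, add_zero, pow_zero, one_mul]
        rw [h3]
        ring
    simp only [h]
    rw [intervalIntegral.integral_const_mul, intervalIntegral.integral_eq_sub_of_hasDerivAt
      (fun t _ => hexpd t) ((continuous_const.mul hexpc).intervalIntegrable _ _)]
    simp only [hYdef]
    ring
  refine ⟨Y 0, fun h => ?_, ?_⟩
  · have := congrFun h ⟨0, hN⟩
    simp [hYdef] at this
  · rw [← hY.eq_vecMul_solutionMatrix hq]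
    funext i
    simp [hYdef, mul_comm]

end Multipliers

/-! ### Continuity of the roots of monic polynomials -/

section Roots

open Polynomial

/-- A monic polynomial of small value at `ρ` has a root near `ρ`, because `P(ρ)` is the product of
the differences `ρ - x` over the roots `x`. -/
theorem exists_isRoot_norm_sub_pow_le {P : ℂ[X]} (hP : P.Monic) (hd : 0 < P.natDegree) (ρ : ℂ) :
    ∃ x, P.IsRoot x ∧ ‖ρ - x‖ ^ P.natDegree ≤ ‖P.eval ρ‖ := by
  have hsp : P.Splits := IsAlgClosed.splits P
  have hcard : Multiset.card P.roots = P.natDegree := hsp.natDegree_eq_card_roots.symm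
  have hne : P.roots.toFinset.Nonempty := by
    rw [Multiset.toFinset_nonempty]
    intro h
    rw [h] at hcard
    simp at hcard
    omega
  obtain ⟨x, hx, hmin⟩ := P.roots.toFinset.exists_min_image (fun x => ‖ρ - x‖) hne
  rw [Multiset.mem_toFinset] at hx
  refine ⟨x, isRoot_of_mem_roots hx, ?_⟩
  have key : ∀ S : Multiset ℂ, (∀ y ∈ S, ‖ρ - x‖ ≤ ‖ρ - y‖) →
      ‖ρ - x‖ ^ Multiset.card S ≤ ‖(S.map fun y => ρ - y).prod‖ := by
    intro S
    induction S using Multiset.induction_on with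
    | empty => simp
    | cons a S ih =>
      intro h
      rw [Multiset.card_cons, Multiset.map_cons, Multiset.prod_cons, norm_mul, pow_succ, mul_comm]
      exact mul_le_mul (h a (Multiset.mem_cons_self _ _))
        (ih fun y hy => h y (Multiset.mem_cons_of_mem hy)) (by positivity) (norm_nonneg _)
  have h := key P.roots fun y hy => hmin y (Multiset.mem_toFinset.mpr hy)
  rw [hcard] at h
  refine h.trans_eq ?_
  conv_rhs => rw [hsp.eq_prod_roots_of_monic hP, eval_multiset_prod, Multiset.map_map]
  simp

variable {T : Type*} [TopologicalSpace T] {P : T → ℂ[X]} {N : ℕ}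

/-- Roots of a monic polynomial depend continuously on parameters: near a root of `P τ₀` there is
a root of `P τ`. -/
theorem eventually_exists_isRoot_near (hN : 0 < N) (hm : ∀ τ, (P τ).Monic)
    (hd : ∀ τ, (P τ).natDegree = N) (hc : Continuous fun x : T × ℂ => (P x.1).eval x.2)
    {τ₀ : T} {ρ₀ : ℂ} (h₀ : (P τ₀).IsRoot ρ₀) {ε : ℝ} (hε : 0 < ε) :
    ∀ᶠ τ in 𝓝 τ₀, ∃ x, (P τ).IsRoot x ∧ ‖x - ρ₀‖ < ε := by
  have h1 : Tendsto (fun τ => ‖(P τ).eval ρ₀‖) (𝓝 τ₀) (𝓝 0) := by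
    have : Continuous fun τ => ‖(P τ).eval ρ₀‖ :=
      (hc.comp (Continuous.prodMk_left ρ₀)).norm
    have h2 := this.tendsto τ₀
    rwa [h₀.eq_zero, norm_zero] at h2
  filter_upwards [h1.eventually (gt_mem_nhds (pow_pos hε N))] with τ hτ
  obtain ⟨x, hx, hle⟩ := exists_isRoot_norm_sub_pow_le (hm τ) ((hd τ).symm ▸ hN) ρ₀
  rw [hd] at hle
  refine ⟨x, hx, ?_⟩
  rw [norm_sub_rev]
  exact lt_of_pow_lt_pow_left₀ N hε.le (hle.trans_lt hτ)

/-- A root singled out by an open condition depends continuously on the parameter. -/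
theorem continuous_of_unique_isRoot (hN : 0 < N) (hm : ∀ τ, (P τ).Monic)
    (hd : ∀ τ, (P τ).natDegree = N) (hc : Continuous fun x : T × ℂ => (P x.1).eval x.2)
    {O : Set (T × ℂ)} (hO : IsOpen O) {σ : T → ℂ} (hσO : ∀ τ, (τ, σ τ) ∈ O)
    (hσ : ∀ τ, (P τ).IsRoot (σ τ))
    (huniq : ∀ τ ρ, (τ, ρ) ∈ O → (P τ).IsRoot ρ → ρ = σ τ) : Continuous σ := by
  rw [continuous_iff_continuousAt]
  intro τ₀
  rw [ContinuousAt, Metric.tendsto_nhds]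
  intro ε hε
  have h1 := hO.mem_nhds (hσO τ₀)
  rw [nhds_prod_eq, Filter.mem_prod_iff] at h1
  obtain ⟨V, hV, B, hB, hVB⟩ := h1
  obtain ⟨δ, hδ, hδB⟩ := Metric.mem_nhds_iff.mp hB
  filter_upwards [hV, eventually_exists_isRoot_near hN hm hd hc (hσ τ₀) (lt_min hε hδ)]
    with τ hτV ⟨x, hx, hxε⟩
  have h2 : (τ, x) ∈ O := hVB ⟨hτV, hδB (by
    rw [Metric.mem_ball, dist_eq_norm]; exact hxε.trans_le (min_le_right _ _))⟩
  rw [← huniq τ x h2 hx, dist_eq_norm]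
  exact hxε.trans_le (min_le_left _ _)

/-- The continuity method: a root in a disc persists along a connected family of polynomials, none
of which has a root on the boundary circle. -/
theorem exists_isRoot_mem_ball_of_preconnected [PreconnectedSpace T] [CompactSpace T] [T2Space T]
    (hN : 0 < N)
    (hm : ∀ τ, (P τ).Monic) (hd : ∀ τ, (P τ).natDegree = N)
    (hc : Continuous fun x : T × ℂ => (P x.1).eval x.2) {e : ℂ} {ε : ℝ}
    (hb : ∀ τ ρ, ‖ρ - e‖ = ε → ¬ (P τ).IsRoot ρ) {τ₀ : T}
    (h₀ : ∃ ρ ∈ Metric.ball e ε, (P τ₀).IsRoot ρ) (τ : T) :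
    ∃ ρ ∈ Metric.ball e ε, (P τ).IsRoot ρ := by
  set S := {τ | ∃ ρ ∈ Metric.ball e ε, (P τ).IsRoot ρ} with hS
  have hopen : IsOpen S := by
    rw [isOpen_iff_mem_nhds]
    rintro τ₁ ⟨ρ, hρ, hroot⟩
    obtain ⟨δ, hδ, hδB⟩ := Metric.isOpen_iff.mp Metric.isOpen_ball ρ hρ
    filter_upwards [eventually_exists_isRoot_near hN hm hd hc hroot hδ] with τ ⟨x, hx, hxδ⟩
    exact ⟨x, hδB (by rwa [Metric.mem_ball, dist_eq_norm]), hx⟩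
  have hclosed : IsClosed S := by
    have h1 : S = Prod.fst '' ((univ ×ˢ Metric.closedBall e ε) ∩
        {x : T × ℂ | (P x.1).eval x.2 = 0}) := by
      ext τ
      constructor
      · rintro ⟨ρ, hρ, hroot⟩
        exact ⟨(τ, ρ), ⟨⟨mem_univ _, Metric.ball_subset_closedBall hρ⟩, hroot⟩, rfl⟩
      · rintro ⟨⟨τ', ρ⟩, ⟨⟨-, hρ⟩, hroot⟩, rfl⟩
        refine ⟨ρ, ?_, hroot⟩
        rw [Metric.mem_closedBall, dist_eq_norm] at hρ
        rw [Metric.mem_ball, dist_eq_norm]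
        exact lt_of_le_of_ne hρ fun h => hb τ' ρ h hroot
    rw [h1]
    exact (((isCompact_univ.prod (isCompact_closedBall e ε)).inter_right
      (isClosed_eq hc continuous_const)).image continuous_fst).isClosed
  have := IsClopen.eq_univ ⟨hclosed, hopen⟩ ⟨τ₀, h₀⟩
  exact (this ▸ mem_univ τ : τ ∈ S)

theorem toFinset_roots_eq_image {Q : ℂ[X]} (hQ : Q ≠ 0) (hd : Q.natDegree = N) {x : Fin N → ℂ}
    (hx : Function.Injective x) (hroot : ∀ i, Q.IsRoot (x i)) :
    Q.roots.toFinset = Finset.univ.image x ∧ Q.roots.Nodup := by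
  have hsub : Finset.univ.image x ⊆ Q.roots.toFinset := by
    intro y hy
    obtain ⟨i, -, rfl⟩ := Finset.mem_image.mp hy
    exact Multiset.mem_toFinset.mpr ((mem_roots hQ).mpr (hroot i))
  have hcard : (Finset.univ.image x).card = N := by
    rw [Finset.card_image_of_injective _ hx, Finset.card_univ, Fintype.card_fin]
  have h1 : Multiset.card Q.roots ≤ N := hd ▸ Q.card_roots'
  have h2 := Multiset.toFinset_card_le Q.roots
  have h3 := Finset.card_le_card hsub
  refine ⟨(Finset.eq_of_subset_of_card_le hsub (by omega)).symm, ?_⟩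
  rw [← Multiset.toFinset_card_eq_card_iff_nodup]
  omega

theorem nodup_roots_iff_derivative {Q : ℂ[X]} (hQ : Q ≠ 0) :
    Q.roots.Nodup ↔ ∀ ρ, Q.IsRoot ρ → ¬ Q.derivative.IsRoot ρ := by
  rw [Multiset.nodup_iff_count_le_one]
  refine forall_congr' fun ρ => ?_
  rw [count_roots, ← not_lt, one_lt_rootMultiplicity_iff_isRoot hQ]
  tauto

end Roots

/-! ### Circles on which the unperturbed multipliers are separated -/

section Separation

/-- Simultaneous recurrence: two far apart terms of a sequence on a torus are close to each other,
and their difference yields `t`. -/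
theorem exists_ge_near_integers {ι : Type*} [Finite ι] (a : ι → ℝ) {ε : ℝ} (hε : 0 < ε) (R : ℝ) :
    ∃ t ≥ R, ∀ i, ∃ k : ℤ, |a i * t - k| < ε := by
  have := Fintype.ofFinite ι
  have : Fact ((0 : ℝ) < 1) := ⟨one_pos⟩
  set R' := max R 1 with hR'
  have hR'0 : 0 < R' := lt_of_lt_of_le one_pos (le_max_right _ _)
  set x : ℕ → ι → AddCircle (1 : ℝ) := fun m i => ((a i * (m * R') : ℝ) : AddCircle (1 : ℝ))
  obtain ⟨y, φ, hφ, hy⟩ := CompactSpace.tendsto_subseq x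
  obtain ⟨n, hn⟩ := Metric.cauchySeq_iff.mp hy.cauchySeq ε hε
  have h1 := hn (n + 1) (by omega) n le_rfl
  have hlt : φ n < φ (n + 1) := hφ (Nat.lt_succ_self n)
  have hle : (1 : ℝ) ≤ (φ (n + 1) : ℝ) - φ n := by
    have : (φ n : ℝ) + 1 ≤ φ (n + 1) := by exact_mod_cast hlt
    linarith
  refine ⟨((φ (n + 1) : ℝ) - φ n) * R', ?_, fun i => ?_⟩
  · calc R ≤ 1 * R' := by rw [one_mul]; exact le_max_left _ _
      _ ≤ _ := by gcongr
  · have h2 := (dist_le_pi_dist _ _ i).trans_lt h1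
    rw [dist_eq_norm] at h2
    simp only [Function.comp_apply, x] at h2
    rw [← AddCircle.coe_sub, AddCircle.norm_eq] at h2
    refine ⟨round ((1 : ℝ)⁻¹ * (a i * (φ (n + 1) * R') - a i * (φ n * R'))), ?_⟩
    rw [mul_one] at h2
    have h3 : ((φ (n + 1) : ℝ) - φ n) * R' = φ (n + 1) * R' - φ n * R' := by ring
    rw [h3, mul_sub]
    exact h2

/-- Finitely many positive multiples of some arbitrarily large `r` stay uniformly away from the
integers. -/
theorem exists_ge_away_from_integers {ι : Type*} [Finite ι] {a : ι → ℝ} (ha : ∀ i, 0 < a i) :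
    ∃ δ > 0, ∀ R : ℝ, ∃ r ≥ R, ∀ i, ∀ k : ℤ, δ ≤ |a i * r - k| := by
  have := Fintype.ofFinite ι
  rcases isEmpty_or_nonempty ι with h | h
  · exact ⟨1, one_pos, fun R => ⟨R, le_rfl, fun i => isEmptyElim i⟩⟩
  obtain ⟨i₁, hi₁⟩ := Finite.exists_max a
  obtain ⟨i₀, hi₀⟩ := Finite.exists_min a
  have hM := ha i₁
  -- all `a i * r₀` lie in `[a i₀ * r₀, 1 / 2]`, and adding a recurrence time `t` changes them only
  -- slightly modulo `1`
  set r₀ := 1 / (2 * a i₁) with hr₀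
  have hr₀0 : 0 < r₀ := by positivity
  have hδ : 0 < a i₀ * r₀ / 2 := by have := ha i₀; positivity
  refine ⟨a i₀ * r₀ / 2, hδ, fun R => ?_⟩
  obtain ⟨t, htR, ht⟩ := exists_ge_near_integers a hδ R
  refine ⟨t + r₀, by linarith, fun i k => ?_⟩
  obtain ⟨m, hm⟩ := ht i
  have h1 : a i₀ * r₀ ≤ a i * r₀ := by gcongr; exact hi₀ i
  have h2 : a i * r₀ ≤ 1 / 2 := by
    calc a i * r₀ ≤ a i₁ * r₀ := by gcongr; exact hi₁ i
      _ = 1 / 2 := by rw [hr₀]; field_simp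
  have h3 : a i₀ * r₀ ≤ |a i * r₀ - (k - m : ℤ)| := by
    rcases le_or_gt (k - m) 0 with h | h
    · have : ((k - m : ℤ) : ℝ) ≤ 0 := by exact_mod_cast h
      exact le_trans (by linarith) (le_abs_self _)
    · have : (1 : ℝ) ≤ ((k - m : ℤ) : ℝ) := by exact_mod_cast h
      exact le_trans (by linarith) (neg_le_abs _)
  have h4 : a i * r₀ - (k - m : ℤ) = (a i * (t + r₀) - k) - (a i * t - m) := by push_cast; ring
  have h5 := abs_sub (a i * (t + r₀) - k) (a i * t - m)
  rw [h4] at h3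
  linarith

/-- The zeros of `1 - e^w` have the moduli `2π|k|`, so `1 - e^w` is bounded below in terms of the
distance of `|w|` to these. -/
theorem le_norm_one_sub_exp {w : ℂ} {δ : ℝ} (hδ : δ ≤ 1 / 2)
    (h : ∀ k : ℤ, 2 * δ ≤ |‖w‖ - 2 * Real.pi * k|) : δ ≤ ‖1 - Complex.exp w‖ := by
  by_contra hlt
  push Not at hlt
  rw [norm_sub_rev] at hlt
  set v := Complex.exp w - 1 with hv
  have h1 := Complex.norm_log_one_add_half_le_self (z := v) (by linarith)
  have hne : 1 + v ≠ 0 := by rw [hv]; simp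
  have h2 : Complex.exp w = Complex.exp (Complex.log (1 + v)) := by
    rw [Complex.exp_log hne, hv]; ring
  obtain ⟨k, hk⟩ := Complex.exp_eq_exp_iff_exists_int.mp h2
  have h3 : ‖w - k * (2 * Real.pi * Complex.I)‖ ≤ 3 / 2 * ‖v‖ := by
    rw [hk]; simpa using h1
  have h4 := (abs_norm_sub_norm_le w (k * (2 * Real.pi * Complex.I))).trans h3
  have h5 : ‖(k * (2 * Real.pi * Complex.I) : ℂ)‖ = 2 * Real.pi * ((|k| : ℤ) : ℝ) := by
    simp [abs_of_pos Real.pi_pos]; ring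
  rw [h5] at h4
  have h6 := h |k|
  linarith [norm_nonneg v]

/-- There are arbitrarily large circles on which the numbers `e^{πωz}`, `ω` running over the roots
of unity of order `N`, have a uniformly positive relative distance. -/
theorem exists_circle_separated {N : ℕ} {η : ℂ} (hη : IsPrimitiveRoot η N) :
    ∃ δ > 0, δ ≤ 1 ∧ ∀ R : ℝ, ∃ r ≥ R, ∀ z : ℂ, ‖z‖ = r → ∀ k l : Fin N, k ≠ l →
      δ * max ‖Complex.exp (η ^ (k : ℕ) * z * Real.pi)‖ ‖Complex.exp (η ^ (l : ℕ) * z * Real.pi)‖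
        ≤ ‖Complex.exp (η ^ (k : ℕ) * z * Real.pi) - Complex.exp (η ^ (l : ℕ) * z * Real.pi)‖ := by
  obtain ⟨δ₀, hδ₀, H⟩ := exists_ge_away_from_integers
    (ι := {q : Fin N × Fin N // q.1 ≠ q.2}) (a := fun q => ‖η ^ (q.1.1 : ℕ) - η ^ (q.1.2 : ℕ)‖ / 2)
    (fun q => by
      have : η ^ (q.1.1 : ℕ) ≠ η ^ (q.1.2 : ℕ) := fun h =>
        q.2 (Fin.ext (hη.pow_inj q.1.1.2 q.1.2.2 h))
      have := norm_pos_iff.mpr (sub_ne_zero.mpr this)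
      positivity)
  refine ⟨min δ₀ (1 / 2), by positivity, (min_le_right _ _).trans (by norm_num), fun R => ?_⟩
  obtain ⟨r, hr, hr'⟩ := H R
  refine ⟨r, hr, fun z hz => ?_⟩
  have key : ∀ k l : Fin N, k ≠ l → min δ₀ (1 / 2) * ‖Complex.exp (η ^ (l : ℕ) * z * Real.pi)‖
      ≤ ‖Complex.exp (η ^ (k : ℕ) * z * Real.pi)
        - Complex.exp (η ^ (l : ℕ) * z * Real.pi)‖ := by
    intro k l hkl
    set w := (η ^ (k : ℕ) - η ^ (l : ℕ)) * z * Real.pi with hw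
    have h1 : min δ₀ (1 / 2) ≤ ‖1 - Complex.exp w‖ := by
      refine le_norm_one_sub_exp (min_le_right _ _) fun m => ?_
      have h2 := hr' ⟨(k, l), hkl⟩ m
      have h3 : ‖w‖ - 2 * Real.pi * m
          = 2 * Real.pi * (‖η ^ (k : ℕ) - η ^ (l : ℕ)‖ / 2 * r - m) := by
        rw [hw, norm_mul, norm_mul, hz, Complex.norm_real, Real.norm_of_nonneg Real.pi_pos.le]
        ring
      rw [h3, abs_mul, abs_of_pos (by positivity)]
      have h4 : (1 : ℝ) ≤ Real.pi := by linarith [Real.pi_gt_three]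
      calc 2 * min δ₀ (1 / 2) ≤ 2 * 1 * δ₀ := by linarith [min_le_left δ₀ (1 / 2)]
        _ ≤ _ := by gcongr
    have h2 : Complex.exp (η ^ (k : ℕ) * z * Real.pi) - Complex.exp (η ^ (l : ℕ) * z * Real.pi)
        = -((1 - Complex.exp w) * Complex.exp (η ^ (l : ℕ) * z * Real.pi)) := by
      rw [sub_mul, ← Complex.exp_add, hw]
      ring_nf
    rw [h2, norm_neg, norm_mul]
    gcongr
  intro k l hkl
  rcases max_cases ‖Complex.exp (η ^ (k : ℕ) * z * Real.pi)‖
    ‖Complex.exp (η ^ (l : ℕ) * z * Real.pi)‖ with h | h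
  · rw [h.1, norm_sub_rev]
    exact key l k hkl.symm
  · rw [h.1]
    exact key k l hkl

variable {ι : Type*} {e : ι → ℂ} {δ : ℝ}

/-- A point on the boundary of the disc of relative radius `δ / 4` around `e k` has a relative
distance of at least `δ / 8` to all `e l`. -/
theorem separated_of_norm_sub_eq (hδ : 0 < δ) (hδ1 : δ ≤ 1)
    (hsep : ∀ k l, k ≠ l → δ * max ‖e k‖ ‖e l‖ ≤ ‖e k - e l‖) {k : ι} {ρ : ℂ}
    (hρ : ‖ρ - e k‖ = δ / 4 * ‖e k‖) (l : ι) : δ / 8 * max ‖e l‖ ‖ρ‖ ≤ ‖e l - ρ‖ := by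
  have h1 : ‖ρ‖ ≤ ‖ρ - e k‖ + ‖e k‖ := by simpa using norm_add_le (ρ - e k) (e k)
  have hk := norm_nonneg (e k)
  have h0 := norm_nonneg ρ
  have hδk : δ * ‖e k‖ ≤ 1 * ‖e k‖ := by gcongr
  have h2 : ‖ρ‖ ≤ 2 * ‖e k‖ := by nlinarith
  by_cases hkl : k = l
  · subst hkl
    rw [norm_sub_rev, hρ]
    have : max ‖e k‖ ‖ρ‖ ≤ 2 * ‖e k‖ := max_le (by linarith) h2
    calc δ / 8 * max ‖e k‖ ‖ρ‖ ≤ δ / 8 * (2 * ‖e k‖) := by gcongr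
      _ = _ := by ring
  · have h3 := hsep k l hkl
    have h4 : ‖e k - e l‖ ≤ ‖ρ - e k‖ + ‖e l - ρ‖ := by
      have := norm_add_le (ρ - e k) (e l - ρ)
      rwa [show ρ - e k + (e l - ρ) = -(e k - e l) by ring, norm_neg] at this
    have h5 : max ‖e l‖ ‖ρ‖ ≤ 2 * max ‖e k‖ ‖e l‖ := by
      have := le_max_left ‖e k‖ ‖e l‖
      have := le_max_right ‖e k‖ ‖e l‖
      have := norm_nonneg (e l)
      exact max_le (by linarith) (by linarith)
    have h6 : δ / 4 * ‖e k‖ ≤ δ / 4 * max ‖e k‖ ‖e l‖ := by gcongr; exact le_max_left _ _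
    have h7 : δ / 8 * max ‖e l‖ ‖ρ‖ ≤ δ / 8 * (2 * max ‖e k‖ ‖e l‖) := by gcongr
    have h8 : 0 ≤ δ * max ‖e k‖ ‖e l‖ := by positivity
    linarith

theorem eq_of_mem_ball_of_mem_ball (hδ : 0 < δ)
    (hsep : ∀ k l, k ≠ l → δ * max ‖e k‖ ‖e l‖ ≤ ‖e k - e l‖) {k l : ι} {ρ : ℂ}
    (hk : ρ ∈ Metric.ball (e k) (δ / 4 * ‖e k‖)) (hl : ρ ∈ Metric.ball (e l) (δ / 4 * ‖e l‖)) :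
    k = l := by
  by_contra hkl
  rw [Metric.mem_ball, dist_eq_norm] at hk hl
  have h3 := hsep k l hkl
  have h4 : ‖e k - e l‖ ≤ ‖ρ - e l‖ + ‖ρ - e k‖ := by
    have := norm_sub_le (ρ - e l) (ρ - e k)
    rwa [show ρ - e l - (ρ - e k) = e k - e l by ring] at this
  have h5 : δ / 4 * ‖e k‖ ≤ δ / 4 * max ‖e k‖ ‖e l‖ := by gcongr; exact le_max_left _ _
  have h6 : δ / 4 * ‖e l‖ ≤ δ / 4 * max ‖e k‖ ‖e l‖ := by gcongr; exact le_max_right _ _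
  have h8 : 0 ≤ δ * max ‖e k‖ ‖e l‖ := by positivity
  linarith

end Separation

/-! ### The discriminant of the characteristic polynomial -/

section Discriminant

open Polynomial

variable {ι : Type*} [Fintype ι] [DecidableEq ι] {M : ℂ → Matrix ι ι ℂ}

theorem continuous_eval_charpoly {T : Type*} [TopologicalSpace T] {M : T → Matrix ι ι ℂ}
    (hM : Continuous M) : Continuous fun x : T × ℂ => (M x.1).charpoly.eval x.2 := by
  simp only [Matrix.eval_charpoly, Matrix.scalar_apply, ← Matrix.smul_one_eq_diagonal]
  exact ((continuous_snd.smul continuous_const).sub (hM.comp continuous_fst)).matrix_det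

theorem eventually_exists_isRoot_charpoly_near {T : Type*} [TopologicalSpace T] [Nonempty ι]
    {M : T → Matrix ι ι ℂ} (hM : Continuous M) {τ₀ : T} {ρ₀ : ℂ}
    (h₀ : (M τ₀).charpoly.IsRoot ρ₀) {ε : ℝ} (hε : 0 < ε) :
    ∀ᶠ τ in 𝓝 τ₀, ∃ x, (M τ).charpoly.IsRoot x ∧ ‖x - ρ₀‖ < ε :=
  eventually_exists_isRoot_near (P := fun τ => (M τ).charpoly) Fintype.card_pos
    (fun _ => Matrix.charpoly_monic _) (fun _ => Matrix.charpoly_natDegree_eq_dim _)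
    (continuous_eval_charpoly hM) h₀ hε

theorem continuous_of_unique_isRoot_charpoly {T : Type*} [TopologicalSpace T] [Nonempty ι]
    {M : T → Matrix ι ι ℂ} (hM : Continuous M) {O : Set (T × ℂ)} (hO : IsOpen O) {σ : T → ℂ}
    (hσO : ∀ τ, (τ, σ τ) ∈ O) (hσ : ∀ τ, (M τ).charpoly.IsRoot (σ τ))
    (huniq : ∀ τ ρ, (τ, ρ) ∈ O → (M τ).charpoly.IsRoot ρ → ρ = σ τ) : Continuous σ :=
  continuous_of_unique_isRoot (P := fun τ => (M τ).charpoly) Fintype.card_pos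
    (fun _ => Matrix.charpoly_monic _) (fun _ => Matrix.charpoly_natDegree_eq_dim _)
    (continuous_eval_charpoly hM) hO hσO hσ huniq

theorem differentiable_coeff_charpoly (hM : ∀ i j, Differentiable ℂ fun μ => M μ i j) (k : ℕ) :
    Differentiable ℂ fun μ => (M μ).charpoly.coeff k := by
  have h : ∀ μ, (M μ).charpoly.coeff k
      = MvPolynomial.eval (fun q : ι × ι => M μ q.1 q.2)
        ((Matrix.charpoly.univ ℂ ι).coeff k) := by
    intro μ
    have h1 := Matrix.charpoly.univ_coeff_eval₂Hom ι (RingHom.id ℂ)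
      (fun q : ι × ι => M μ q.1 q.2) k
    exact h1.symm
  simp only [h, MvPolynomial.eval_eq']
  exact Differentiable.fun_sum fun d _ => (differentiable_const _).mul
    (Differentiable.fun_finsetProd fun q _ => (hM q.1 q.2).pow _)

theorem differentiable_matrix_pow (hM : ∀ i j, Differentiable ℂ fun μ => M μ i j) (k : ℕ) :
    ∀ i j, Differentiable ℂ fun μ => (M μ ^ k) i j := by
  induction k with
  | zero => intro i j; simp only [pow_zero]; exact differentiable_const _
  | succ k ih =>
    intro i j
    simp only [pow_succ, Matrix.mul_apply]
    exact Differentiable.fun_sum fun l _ => (ih i l).mul (hM l j)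

/-- A form of the discriminant of the characteristic polynomial `χ` of `M` which is visibly a
polynomial in the entries of `M`: the determinant of `χ'(M)`, the product of the values of `χ'` at
the eigenvalues. -/
noncomputable def charpolyDiscr (M : Matrix ι ι ℂ) : ℂ :=
  (aeval M M.charpoly.derivative).det

theorem charpolyDiscr_eq_zero_iff [Nonempty ι] (M : Matrix ι ι ℂ) :
    charpolyDiscr M = 0 ↔ ∃ ρ, M.charpoly.IsRoot ρ ∧ M.charpoly.derivative.IsRoot ρ := by
  have h1 : charpolyDiscr M = 0 ↔ (0 : ℂ) ∈ spectrum ℂ (aeval M M.charpoly.derivative) := by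
    rw [spectrum.zero_mem_iff, Matrix.isUnit_iff_isUnit_det, isUnit_iff_ne_zero, not_not,
      charpolyDiscr]
  rw [h1, spectrum.map_polynomial_aeval_of_nonempty M _
    (spectrum.nonempty_of_isAlgClosed_of_finiteDimensional ℂ M)]
  simp only [mem_image, Matrix.mem_spectrum_iff_isRoot_charpoly]
  rfl

theorem differentiable_charpolyDiscr (hM : ∀ i j, Differentiable ℂ fun μ => M μ i j) :
    Differentiable ℂ fun μ => charpolyDiscr (M μ) := by
  have h1 : ∀ μ, aeval (M μ) (M μ).charpoly.derivative
      = ∑ k ∈ Finset.range (Fintype.card ι + 1),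
        ((M μ).charpoly.coeff (k + 1) * (k + 1)) • M μ ^ k := by
    intro μ
    rw [aeval_eq_sum_range' (n := Fintype.card ι + 1)]
    · simp only [coeff_derivative]
    · refine lt_of_le_of_lt (natDegree_derivative_le _) ?_
      rw [Matrix.charpoly_natDegree_eq_dim]
      omega
  simp only [charpolyDiscr, h1, Matrix.det_apply]
  refine Differentiable.fun_sum fun τ _ => Differentiable.const_smul
    (Differentiable.fun_finsetProd fun i _ => ?_) _
  simp only [Matrix.sum_apply, Matrix.smul_apply, smul_eq_mul]
  exact Differentiable.fun_sum fun k _ =>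
    ((differentiable_coeff_charpoly hM _).mul (differentiable_const _)).mul
      (differentiable_matrix_pow hM k _ _)

end Discriminant

/-! ### Multipliers on large circles -/

section Circle

variable {N : ℕ}

theorem continuous_solutionMatrix {q₀ q₁ : Fin N → ℝ → ℂ}
    (h₀ : ∀ l, LocallyIntegrable (q₀ l) volume) (h₁ : ∀ l, LocallyIntegrable (q₁ l) volume)
    (x : ℝ) : Continuous fun ζ : ℂ => solutionMatrix (fun l t => q₀ l t + ζ * q₁ l t) x :=
  continuous_matrix fun k j => (differentiable_solutionMatrix h₀ h₁ x k j).continuous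

/-- On suitable arbitrarily large circles `|z| = R` the multipliers of `y^(N) = z^N y + ∑ r_l y^(l)`
are close, in the relative sense, to the unperturbed multipliers `e^{πωz}`: each of the pairwise
disjoint discs around these numbers contains a multiplier. -/
theorem exists_circle_multipliers {r : Fin N → ℝ → ℂ}
    (hN : 0 < N) (hr : ∀ l, LocallyIntegrable (r l) volume)
    (hlast : ∀ (l : Fin N) (t : ℝ), ¬ (l : ℕ) + 1 < N → r l t = 0) {η : ℂ}
    (hη : IsPrimitiveRoot η N) :
    ∃ δ > 0, ∃ R > 0, ∀ z : ℂ, ‖z‖ = R →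
      (∀ k l : Fin N, ∀ ρ,
        ρ ∈ Metric.ball (Complex.exp (η ^ (k : ℕ) * z * Real.pi))
          (δ / 4 * ‖Complex.exp (η ^ (k : ℕ) * z * Real.pi)‖) →
        ρ ∈ Metric.ball (Complex.exp (η ^ (l : ℕ) * z * Real.pi))
          (δ / 4 * ‖Complex.exp (η ^ (l : ℕ) * z * Real.pi)‖) → k = l) ∧
      ∀ k : Fin N, ∃ ρ ∈ Metric.ball (Complex.exp (η ^ (k : ℕ) * z * Real.pi))
          (δ / 4 * ‖Complex.exp (η ^ (k : ℕ) * z * Real.pi)‖),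
        (solutionMatrix (spectralCoeff r (z ^ N) 1) Real.pi).charpoly.IsRoot ρ := by
  obtain ⟨δ, hδ, hδ1, H⟩ := exists_circle_separated hη
  obtain ⟨R, hR, hsep⟩ := H (max 1
    ((1 + 1 / (δ / 8)) * (∫ t in (0 : ℝ)..Real.pi, ∑ l, ‖r l t‖) + 1))
  have hR1 : 1 ≤ R := (le_max_left _ _).trans hR
  have hR2 : (1 + 1 / (δ / 8)) * (∫ t in (0 : ℝ)..Real.pi, ∑ l, ‖r l t‖) < R :=
    lt_of_lt_of_le (lt_add_one _) ((le_max_right _ _).trans hR)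
  refine ⟨δ, hδ, R, by linarith, fun z hz => ⟨fun k l ρ hk hl =>
    eq_of_mem_ball_of_mem_ball (e := fun k : Fin N => Complex.exp (η ^ (k : ℕ) * z * Real.pi)) hδ
      (hsep z hz) hk hl, fun k => ?_⟩⟩
  set e : Fin N → ℂ := fun k => Complex.exp (η ^ (k : ℕ) * z * Real.pi) with he
  have hek : 0 < ‖e k‖ := norm_pos_iff.mpr (Complex.exp_ne_zero _)
  -- the homotopy from the unperturbed equation
  set M : unitInterval → Matrix (Fin N) (Fin N) ℂ := fun s =>
    solutionMatrix (spectralCoeff r (z ^ N) ((s : ℝ) : ℂ)) Real.pi with hM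
  have hMc : Continuous M := by
    have h1 := continuous_solutionMatrix (q₀ := fun l _ => if (l : ℕ) = 0 then z ^ N else 0)
      (fun l => locallyIntegrable_const _) hr Real.pi
    exact h1.comp (Complex.continuous_ofReal.comp continuous_subtype_val)
  have h := exists_isRoot_mem_ball_of_preconnected (P := fun s => (M s).charpoly) (N := N) hN
    (fun s => Matrix.charpoly_monic _)
    (fun s => by rw [Matrix.charpoly_natDegree_eq_dim, Fintype.card_fin])
    (continuous_eval_charpoly hMc) (e := e k) (ε := δ / 4 * ‖e k‖) ?_ (τ₀ := 0) ?_ 1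
  · simpa [hM] using h
  · intro s ρ hρ
    have hs : ‖(((s : ℝ) : ℂ))‖ ≤ 1 := by
      rw [Complex.norm_real, Real.norm_of_nonneg s.2.1]; exact s.2.2
    have hρ0 : ρ ≠ 0 := by
      rintro rfl
      rw [zero_sub, norm_neg] at hρ
      nlinarith
    refine not_isRoot_charpoly_of_separated hr hlast hη hs hρ0 (c := δ / 8) (by positivity)
      (by rw [hz]; exact hR1) (by rw [hz]; exact hR2) fun l hl => ?_
    exact separated_of_norm_sub_eq (e := e) hδ hδ1 (hsep z hz) hρ ⟨l, hl⟩
  · refine ⟨e k, Metric.mem_ball_self (by positivity), ?_⟩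
    have h1 := isRoot_charpoly_unperturbed hN hr (η ^ (k : ℕ) * z)
    have h2 : (η ^ (k : ℕ) * z) ^ N = z ^ N := by
      rw [mul_pow, ← pow_mul, mul_comm (k : ℕ), pow_mul, hη.pow_eq_one, one_pow, one_mul]
    rw [h2] at h1
    simpa [hM, he] using h1

end Circle

/-! ### The surface in terms of the characteristic polynomial -/

section Surface

variable {n : ℕ} {p : Fin n → ℝ → ℝ}

/-- No sign appears, because the order `2 * n` is even. -/
theorem Δ_eq_eval_charpoly (p : Fin n → ℝ → ℝ) (μ ρ : ℂ) :
    Δ p μ ρ = (U p μ).charpoly.eval ρ := by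
  have h : Matrix.scalar (Fin (2 * n)) ρ - U p μ
      = -(U p μ - ρ • (1 : Matrix (Fin (2 * n)) (Fin (2 * n)) ℂ)) := by
    rw [neg_sub, Matrix.scalar_apply, Matrix.smul_one_eq_diagonal]
  rw [Matrix.eval_charpoly, Δ, h, Matrix.det_neg, Fintype.card_fin]
  simp

theorem mem_surface_iff (p : Fin n → ℝ → ℝ) (z : ℂ × ℂ) :
    z ∈ surface p ↔ (U p z.1).charpoly.IsRoot z.2 := by
  rw [surface, mem_ofPred_eq, Δ_eq_eval_charpoly, Polynomial.IsRoot]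

theorem mem_discriminantSet_iff (p : Fin n → ℝ → ℝ) (μ : ℂ) :
    μ ∈ discriminantSet p ↔
      ∃ ρ, (U p μ).charpoly.IsRoot ρ ∧ (U p μ).charpoly.derivative.IsRoot ρ := by
  simp only [discriminantSet, mem_ofPred_eq, Δ_eq_eval_charpoly, Polynomial.deriv,
    Polynomial.IsRoot]

theorem notMem_discriminantSet_iff (p : Fin n → ℝ → ℝ) (μ : ℂ) :
    μ ∉ discriminantSet p ↔ (U p μ).charpoly.roots.Nodup := by
  rw [mem_discriminantSet_iff, nodup_roots_iff_derivative (Matrix.charpoly_monic _).ne_zero]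
  push Not
  rfl

theorem differentiable_U (hn : 1 ≤ n) (hp : IsCoefficients p) (k j : Fin (2 * n)) :
    Differentiable ℂ fun μ => U p μ k j := by
  have h := differentiable_solutionMatrix (q₀ := fun l t => lowerCoeff p l t)
    (q₁ := fun l _ => if (l : ℕ) = 0 then (-1) ^ n else 0) hp.locallyIntegrable_lowerCoeff
    (fun l => locallyIntegrable_const _) Real.pi k j
  convert h using 1
  funext μ
  rw [U_eq_solutionMatrix hn hp]
  congr 2
  funext l t
  simp only [equationCoeff, spectralCoeff]
  split_ifs <;> ring

theorem continuous_U (hn : 1 ≤ n) (hp : IsCoefficients p) : Continuous (U p) :=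
  continuous_matrix fun k j => (differentiable_U hn hp k j).continuous

end Surface

/-! ### Connectedness of the surface -/

section Connectedness

open Polynomial

variable {n : ℕ} {p : Fin n → ℝ → ℝ}

theorem mk_mem_surface_iff {μ ρ : ℂ} : (μ, ρ) ∈ surface p ↔ (U p μ).charpoly.IsRoot ρ :=
  mem_surface_iff p (μ, ρ)

theorem mk_mem_unramifiedPart {μ ρ : ℂ} (h : (U p μ).charpoly.IsRoot ρ)
    (hd : (U p μ).charpoly.roots.Nodup) : (μ, ρ) ∈ unramifiedPart p :=
  ⟨mk_mem_surface_iff.mpr h, (notMem_discriminantSet_iff p μ).mpr hd⟩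

theorem exists_injective_isRoot {Q : ℂ[X]} {N : ℕ} (hd : Q.natDegree = N)
    (hQ : Q.roots.Nodup) : ∃ y : Fin N → ℂ, Function.Injective y ∧ ∀ i, Q.IsRoot (y i) := by
  have hcard : Q.roots.toFinset.card = N := by
    rw [Multiset.toFinset_card_of_nodup hQ, ← (IsAlgClosed.splits _).natDegree_eq_card_roots, hd]
  exact ⟨fun i => ((Finset.equivFinOfCardEq hcard).symm i : ℂ),
    Subtype.val_injective.comp (Finset.equivFinOfCardEq hcard).symm.injective,
    fun i => isRoot_of_mem_roots
      (Multiset.mem_toFinset.mp ((Finset.equivFinOfCardEq hcard).symm i).2)⟩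

/-- A path-connected piece of the unramified part which contains a full fibre: the lift of a large
circle `|z| = R`, `μ = (-1)^n z^(2n)`, by the multiplier close to `e^{πz}`. The point `η^k R`, `η` a
primitive root of unity of order `2n`, lies over the same `μ` as `R` and contributes the `k`-th
point of the fibre. -/
theorem exists_isPathConnected_full_fibre (hn : 1 ≤ n) (hp : IsCoefficients p) :
    ∃ C ⊆ unramifiedPart p, IsPathConnected C ∧ ∃ μ₀ ∉ discriminantSet p,
      ∀ ρ, (μ₀, ρ) ∈ surface p → (μ₀, ρ) ∈ C := by
  have hN : 0 < 2 * n := by omega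
  have : Nonempty (Fin (2 * n)) := ⟨⟨0, hN⟩⟩
  obtain ⟨η, hη⟩ : ∃ η : ℂ, IsPrimitiveRoot η (2 * n) :=
    ⟨_, Complex.isPrimitiveRoot_exp (2 * n) hN.ne'⟩
  obtain ⟨δ, hδ, R, hR, H⟩ := exists_circle_multipliers hN hp.locallyIntegrable_lowerCoeff
    (fun l t hl => lowerCoeff_of_not_lt p hl t) hη
  set m : ℂ → ℂ := fun z => (-1) ^ n * z ^ (2 * n) with hm
  have hU : ∀ z, solutionMatrix (spectralCoeff (lowerCoeff p) (z ^ (2 * n)) 1) Real.pi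
      = U p (m z) := by
    intro z
    rw [U_eq_solutionMatrix hn hp, equationCoeff, hm, ← mul_assoc, ← mul_pow]
    simp
  simp only [hU] at H
  set e : ℂ → Fin (2 * n) → ℂ := fun z k => Complex.exp (η ^ (k : ℕ) * z * Real.pi) with he
  set D : ℂ → Fin (2 * n) → Set ℂ := fun z k => Metric.ball (e z k) (δ / 4 * ‖e z k‖) with hD
  have hdisj : ∀ z, ‖z‖ = R → ∀ k l ρ, ρ ∈ D z k → ρ ∈ D z l → k = l := fun z hz => (H z hz).1
  have hex : ∀ z : Metric.sphere (0 : ℂ) R, ∀ k, ∃ ρ ∈ D z k, (U p (m z)).charpoly.IsRoot ρ :=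
    fun z => (H z (by simp)).2
  choose x hxD hxroot using hex
  have hmonic : ∀ μ, (U p μ).charpoly.Monic := fun μ => Matrix.charpoly_monic _
  have hdeg : ∀ μ, (U p μ).charpoly.natDegree = 2 * n := fun μ => by
    rw [Matrix.charpoly_natDegree_eq_dim, Fintype.card_fin]
  have hinj : ∀ z, Function.Injective (x z) := fun z k l hkl =>
    hdisj z (by simp) k l (x z k) (hxD z k) (hkl ▸ hxD z l)
  -- the `2n` multipliers in the disjoint discs are all roots, and they are simple
  have hall : ∀ z : Metric.sphere (0 : ℂ) R,
      (U p (m z)).charpoly.roots.toFinset = Finset.univ.image (x z) ∧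
        (U p (m z)).charpoly.roots.Nodup := fun z =>
    toFinset_roots_eq_image (hmonic _).ne_zero (hdeg _) (hinj z) (hxroot z)
  have hmem : ∀ (z : Metric.sphere (0 : ℂ) R) ρ, (U p (m z)).charpoly.IsRoot ρ →
      ∃ k, x z k = ρ := by
    intro z ρ hρ
    have h1 : ρ ∈ (U p (m z)).charpoly.roots.toFinset :=
      Multiset.mem_toFinset.mpr ((mem_roots (hmonic _).ne_zero).mpr hρ)
    rw [(hall z).1] at h1
    obtain ⟨k, -, hk⟩ := Finset.mem_image.mp h1
    exact ⟨k, hk⟩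
  have hmc : Continuous fun z : Metric.sphere (0 : ℂ) R => m z :=
    continuous_const.mul (continuous_subtype_val.pow _)
  set σ : Metric.sphere (0 : ℂ) R → ℂ := fun z => x z ⟨0, hN⟩ with hσ
  have huniq : ∀ (z : Metric.sphere (0 : ℂ) R) ρ k, ρ ∈ D z k → (U p (m z)).charpoly.IsRoot ρ →
      ρ = x z k := by
    intro z ρ k hρ hroot
    obtain ⟨l, hl⟩ := hmem z ρ hroot
    rw [← hl]
    congr 1
    exact hdisj z (by simp) l k ρ (hl ▸ hxD z l) hρ
  have hσc : Continuous σ := by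
    have hec : Continuous fun w : Metric.sphere (0 : ℂ) R × ℂ => e w.1 ⟨0, hN⟩ :=
      Complex.continuous_exp.comp ((continuous_const.mul
        (continuous_subtype_val.comp continuous_fst)).mul continuous_const)
    have hO : IsOpen {w : Metric.sphere (0 : ℂ) R × ℂ | w.2 ∈ D w.1 ⟨0, hN⟩} := by
      simp only [hD, Metric.mem_ball, dist_eq_norm]
      exact isOpen_lt (continuous_snd.sub hec).norm (continuous_const.mul hec.norm)
    have hMc : Continuous fun z : Metric.sphere (0 : ℂ) R => U p (m z) :=
      (continuous_U hn hp).comp hmc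
    exact continuous_of_unique_isRoot_charpoly hMc hO (fun z => hxD z _) (fun z => hxroot z _)
      (fun z ρ hO hroot => huniq z ρ _ hO hroot)
  have : PathConnectedSpace (Metric.sphere (0 : ℂ) R) :=
    isPathConnected_iff_pathConnectedSpace.mp
      (isPathConnected_sphere (by rw [Complex.rank_real_complex]; exact Nat.one_lt_ofNat) 0 hR.le)
  have hRs : (R : ℂ) ∈ Metric.sphere (0 : ℂ) R := by
    simp [abs_of_pos hR]
  refine ⟨range fun z : Metric.sphere (0 : ℂ) R => (m z, σ z), ?_,
    isPathConnected_range (hmc.prodMk hσc), m R, ?_, ?_⟩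
  · rintro _ ⟨z, rfl⟩
    exact mk_mem_unramifiedPart (hxroot z ⟨0, hN⟩) (hall z).2
  · exact (notMem_discriminantSet_iff p (m R)).mpr (hall ⟨R, hRs⟩).2
  · intro ρ hρ
    have hroot : (U p (m R)).charpoly.IsRoot ρ := mk_mem_surface_iff.mp hρ
    obtain ⟨k, hk⟩ := hmem ⟨R, hRs⟩ ρ hroot
    -- the disc of index `k` over `R` is the disc of index `0` over `η ^ k * R`
    have hnorm : ‖η‖ = 1 := hη.norm'_eq_one hN.ne'
    have hmz : m (η ^ (k : ℕ) * R) = m R := by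
      simp only [hm]
      rw [mul_pow, ← pow_mul, mul_comm (k : ℕ), pow_mul, hη.pow_eq_one, one_pow, one_mul]
    have hz : η ^ (k : ℕ) * (R : ℂ) ∈ Metric.sphere (0 : ℂ) R := by
      simp [hnorm, abs_of_pos hR]
    refine ⟨⟨η ^ (k : ℕ) * R, hz⟩, Prod.ext hmz (Eq.symm ?_)⟩
    refine huniq ⟨_, hz⟩ ρ ⟨0, hN⟩ ?_ ?_
    · have h1 := hxD ⟨R, hRs⟩ k
      rw [hk] at h1
      simpa [hD, he] using h1
    · have h1 := hxroot ⟨R, hRs⟩ k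
      rw [hk] at h1
      simpa only [hmz] using h1

theorem not_accPt_discriminantSet (hn : 1 ≤ n) (hp : IsCoefficients p) (μ : ℂ) :
    ¬ AccPt μ (𝓟 (discriminantSet p)) := by
  have : Nonempty (Fin (2 * n)) := ⟨⟨0, by omega⟩⟩
  have hiff : ∀ μ, μ ∈ discriminantSet p ↔ charpolyDiscr (U p μ) = 0 := fun μ => by
    rw [mem_discriminantSet_iff, charpolyDiscr_eq_zero_iff]
  have han : AnalyticOnNhd ℂ (fun μ => charpolyDiscr (U p μ)) univ :=
    (differentiable_charpolyDiscr (differentiable_U hn hp)).differentiableOn.analyticOnNhd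
      isOpen_univ
  obtain ⟨-, -, -, μ₀, hμ₀, -⟩ := exists_isPathConnected_full_fibre hn hp
  intro hacc
  rw [accPt_iff_frequently_nhdsNE] at hacc
  refine hμ₀ ((hiff μ₀).mpr ?_)
  exact han.eqOn_zero_of_preconnected_of_frequently_eq_zero isPreconnected_univ (mem_univ μ)
    (hacc.mono fun ν hν => (hiff ν).mp hν) (mem_univ μ₀)

theorem isPreconnected_compl_discriminantSet (hn : 1 ≤ n) (hp : IsCoefficients p) :
    IsPreconnected (discriminantSet p)ᶜ := by
  have : DiscreteTopology (discriminantSet p) :=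
    discreteTopology_of_noAccPts fun x _ => not_accPt_discriminantSet hn hp x
  have hc : (discriminantSet p).Countable :=
    Set.countable_coe_iff.mp (TopologicalSpace.separableSpace_iff_countable.mp inferInstance)
  exact (hc.isPathConnected_compl_of_one_lt_rank
    (by rw [Complex.rank_real_complex]; exact Nat.one_lt_ofNat)).isConnected.isPreconnected

theorem ncard_fibre {μ : ℂ} (hμ : μ ∉ discriminantSet p) :
    {ρ : ℂ | (μ, ρ) ∈ surface p}.ncard = 2 * n := by
  have h1 : {ρ : ℂ | (μ, ρ) ∈ surface p} = ((U p μ).charpoly.roots.toFinset : Set ℂ) := by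
    ext ρ
    simp only [mem_ofPred_eq, mem_surface_iff, Finset.mem_coe, Multiset.mem_toFinset,
      mem_roots (Matrix.charpoly_monic (U p μ)).ne_zero]
  rw [h1, Set.ncard_coe_finset,
    Multiset.toFinset_card_of_nodup ((notMem_discriminantSet_iff p μ).mp hμ),
    ← (IsAlgClosed.splits _).natDegree_eq_card_roots, Matrix.charpoly_natDegree_eq_dim,
    Fintype.card_fin]

/-- Path lifting over a small disc around a point outside the discriminant set: there the surface is
a union of graphs of continuous functions, so a point of it is joined to points over every other
point of the disc. -/
theorem exists_ball_sections (hn : 1 ≤ n) (hp : IsCoefficients p) {μ₁ : ℂ}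
    (hμ₁ : μ₁ ∉ discriminantSet p) :
    ∃ d > 0, Metric.ball μ₁ d ⊆ (discriminantSet p)ᶜ ∧
      ∀ μ ∈ Metric.ball μ₁ d, ∀ ρ, (μ, ρ) ∈ surface p →
        ∀ ν ∈ Metric.ball μ₁ d, ∃ ρ', JoinedIn (unramifiedPart p) (μ, ρ) (ν, ρ') := by
  have hN : 0 < 2 * n := by omega
  have : Nonempty (Fin (2 * n)) := ⟨⟨0, hN⟩⟩
  have hmonic : ∀ μ, (U p μ).charpoly.Monic := fun μ => Matrix.charpoly_monic _
  have hdeg : ∀ μ, (U p μ).charpoly.natDegree = 2 * n := fun μ => by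
    rw [Matrix.charpoly_natDegree_eq_dim, Fintype.card_fin]
  have hnodup := (notMem_discriminantSet_iff p μ₁).mp hμ₁
  obtain ⟨y, hyinj, hyroot⟩ := exists_injective_isRoot (hdeg μ₁) hnodup
  -- disjoint discs around the roots over `μ₁`
  obtain ⟨ε, hε, hdisj⟩ : ∃ ε > 0, ∀ i j ρ, ρ ∈ Metric.ball (y i) ε → ρ ∈ Metric.ball (y j) ε →
      i = j := by
    have h1 : ∀ q : Fin (2 * n) × Fin (2 * n), ∃ ε > 0, q.1 ≠ q.2 →
        2 * ε ≤ dist (y q.1) (y q.2) := by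
      intro q
      by_cases hq : q.1 = q.2
      · exact ⟨1, one_pos, fun h => absurd hq h⟩
      · exact ⟨dist (y q.1) (y q.2) / 2, half_pos (dist_pos.mpr (hyinj.ne hq)), fun _ => by
          linarith⟩
    choose f hf hf2 using h1
    have : Nonempty (Fin (2 * n) × Fin (2 * n)) := ⟨(⟨0, hN⟩, ⟨0, hN⟩)⟩
    obtain ⟨q₀, hq₀⟩ := Finite.exists_min f
    refine ⟨f q₀, hf q₀, fun i j ρ hi hj => ?_⟩
    by_contra hij
    have h2 := hf2 (i, j) hij
    have h3 := hq₀ (i, j)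
    have h4 := dist_triangle_left (y i) (y j) ρ
    rw [Metric.mem_ball] at hi hj
    simp only at h2
    linarith
  have hev : ∀ᶠ μ in 𝓝 μ₁, ∀ i, ∃ x, (U p μ).charpoly.IsRoot x ∧ ‖x - y i‖ < ε :=
    eventually_all.mpr fun i =>
      eventually_exists_isRoot_charpoly_near (continuous_U hn hp) (hyroot i) hε
  obtain ⟨d, hd, hball⟩ := Metric.eventually_nhds_iff_ball.mp hev
  have hex : ∀ μ : Metric.ball μ₁ d, ∀ i, ∃ x, (U p μ).charpoly.IsRoot x ∧ ‖x - y i‖ < ε :=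
    fun μ => hball μ μ.2
  choose x hxroot hxε using hex
  have hxB : ∀ μ i, x μ i ∈ Metric.ball (y i) ε := fun μ i => by
    rw [Metric.mem_ball, dist_eq_norm]; exact hxε μ i
  have hinj : ∀ μ, Function.Injective (x μ) := fun μ i j hij =>
    hdisj i j (x μ i) (hxB μ i) (hij ▸ hxB μ j)
  have hall : ∀ μ : Metric.ball μ₁ d, (U p μ).charpoly.roots.toFinset = Finset.univ.image (x μ) ∧
      (U p μ).charpoly.roots.Nodup := fun μ =>
    toFinset_roots_eq_image (hmonic _).ne_zero (hdeg _) (hinj μ) (hxroot μ)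
  have hmem : ∀ (μ : Metric.ball μ₁ d) ρ, (U p μ).charpoly.IsRoot ρ → ∃ k, x μ k = ρ := by
    intro μ ρ hρ
    have h1 : ρ ∈ (U p μ).charpoly.roots.toFinset :=
      Multiset.mem_toFinset.mpr ((mem_roots (hmonic _).ne_zero).mpr hρ)
    rw [(hall μ).1] at h1
    obtain ⟨k, -, hk⟩ := Finset.mem_image.mp h1
    exact ⟨k, hk⟩
  have hxc : ∀ i, Continuous fun μ => x μ i := by
    intro i
    have hMc : Continuous fun μ : Metric.ball μ₁ d => U p μ :=
      (continuous_U hn hp).comp continuous_subtype_val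
    have hO : IsOpen {w : Metric.ball μ₁ d × ℂ | w.2 ∈ Metric.ball (y i) ε} :=
      Metric.isOpen_ball.preimage continuous_snd
    refine continuous_of_unique_isRoot_charpoly hMc hO (fun μ => hxB μ i) (fun μ => hxroot μ i)
      fun μ ρ hO hroot => ?_
    obtain ⟨l, hl⟩ := hmem μ ρ hroot
    rw [← hl]
    congr 1
    exact hdisj l i ρ (hl ▸ hxB μ l) hO
  have : PathConnectedSpace (Metric.ball μ₁ d) := isPathConnected_iff_pathConnectedSpace.mp
    ((convex_ball μ₁ d).isPathConnected ⟨μ₁, Metric.mem_ball_self hd⟩)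
  have hsub : ∀ i, (range fun μ : Metric.ball μ₁ d => ((μ : ℂ), x μ i)) ⊆ unramifiedPart p := by
    rintro i _ ⟨μ, rfl⟩
    exact mk_mem_unramifiedPart (hxroot μ i) (hall μ).2
  have hjoin : ∀ i (μ ν : Metric.ball μ₁ d),
      JoinedIn (unramifiedPart p) ((μ : ℂ), x μ i) ((ν : ℂ), x ν i) := fun i μ ν =>
    ((isPathConnected_range (continuous_subtype_val.prodMk (hxc i))).joinedIn _
      (mem_range_self μ) _ (mem_range_self ν)).mono (hsub i)
  refine ⟨d, hd, fun μ hμ => (notMem_discriminantSet_iff p μ).mpr (hall ⟨μ, hμ⟩).2,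
    fun μ hμ ρ hρ ν hν => ?_⟩
  have hroot : (U p μ).charpoly.IsRoot ρ := mk_mem_surface_iff.mp hρ
  obtain ⟨i, hi⟩ := hmem ⟨μ, hμ⟩ ρ hroot
  have h := hjoin i ⟨μ, hμ⟩ ⟨ν, hν⟩
  rw [hi] at h
  exact ⟨_, h⟩

theorem isPathConnected_unramifiedPart (hn : 1 ≤ n) (hp : IsCoefficients p) :
    IsPathConnected (unramifiedPart p) := by
  obtain ⟨C, hCsub, hC, μ₀, hμ₀, hfib⟩ := exists_isPathConnected_full_fibre hn hp
  -- every point is joined to some point of the fibre over `μ₀`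
  -- because the set of `μ` over which `w` is joined to some point is open and closed in the
  -- complement of the discriminant set
  have key : ∀ w ∈ unramifiedPart p, ∃ ρ, JoinedIn (unramifiedPart p) w (μ₀, ρ) := by
    intro w hw
    set A : Set ℂ := {μ | ∃ ρ, JoinedIn (unramifiedPart p) w (μ, ρ)} with hA
    have hAsub : A ⊆ (discriminantSet p)ᶜ := fun μ ⟨ρ, hρ⟩ => hρ.target_mem.2
    have hAopen : IsOpen A := by
      rw [Metric.isOpen_iff]
      rintro μ ⟨ρ, hρ⟩
      obtain ⟨d, hd, -, h⟩ := exists_ball_sections hn hp hρ.target_mem.2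
      refine ⟨d, hd, fun ν hν => ?_⟩
      obtain ⟨ρ', hρ'⟩ := h μ (Metric.mem_ball_self hd) ρ hρ.target_mem.1 ν hν
      exact ⟨ρ', hρ.trans hρ'⟩
    have hBopen : IsOpen ((discriminantSet p)ᶜ \ A) := by
      rw [Metric.isOpen_iff]
      rintro μ ⟨hμ, hμA⟩
      obtain ⟨d, hd, hsub, h⟩ := exists_ball_sections hn hp hμ
      refine ⟨d, hd, fun ν hν => ⟨hsub hν, fun ⟨ρ, hρ⟩ => hμA ?_⟩⟩
      obtain ⟨ρ₁, h1⟩ := h ν hν ρ hρ.target_mem.1 μ (Metric.mem_ball_self hd)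
      exact ⟨ρ₁, hρ.trans h1⟩
    have hsub := (isPreconnected_compl_discriminantSet hn hp).subset_left_of_subset_union hAopen
      hBopen disjoint_sdiff_right (by rw [union_sdiff_self]; exact subset_union_right)
      ⟨w.1, hw.2, w.2, JoinedIn.refl hw⟩
    exact hsub hμ₀
  refine isPathConnected_iff.mpr ⟨hC.nonempty.mono hCsub, fun w hw v hv => ?_⟩
  obtain ⟨ρ, hρ⟩ := key w hw
  obtain ⟨ρ', hρ'⟩ := key v hv
  exact hρ.trans (((hC.joinedIn _ (hfib ρ hρ.target_mem.1) _ (hfib ρ' hρ'.target_mem.1)).mono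
    hCsub).trans hρ'.symm)

theorem surface_subset_closure (hn : 1 ≤ n) (hp : IsCoefficients p) :
    surface p ⊆ closure (unramifiedPart p) := by
  rintro ⟨μ, ρ⟩ h
  rw [Metric.mem_closure_iff]
  intro ε hε
  have : Nonempty (Fin (2 * n)) := ⟨⟨0, by omega⟩⟩
  have h1 := (eventually_exists_isRoot_charpoly_near (continuous_U hn hp)
    (mk_mem_surface_iff.mp h) hε).and (Metric.ball_mem_nhds μ hε)
  have h2 : ∀ᶠ ν in 𝓝[≠] μ, ν ∉ discriminantSet p := by
    have := not_accPt_discriminantSet hn hp μ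
    rwa [accPt_iff_frequently_nhdsNE, not_frequently] at this
  obtain ⟨ν, ⟨⟨x, hx, hxε⟩, hν⟩, hνZ⟩ := ((h1.filter_mono nhdsWithin_le_nhds).and h2).exists
  refine ⟨(ν, x), ⟨mk_mem_surface_iff.mpr hx, hνZ⟩, ?_⟩
  rw [dist_comm, Prod.dist_eq]
  exact max_lt hν (by rw [dist_eq_norm]; exact hxε)

end Connectedness
end PeriodicOperator

theorem lemma2p0 (n : ℕ) (hn : 1 ≤ n) (p : Fin n → ℝ → ℝ)
    (hp : PeriodicOperator.IsCoefficients p) :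
    (∀ μ : ℂ, ¬ AccPt μ (Filter.principal (PeriodicOperator.discriminantSet p))) ∧
    (∀ μ : ℂ, μ ∉ PeriodicOperator.discriminantSet p →
      {ρ : ℂ | (μ, ρ) ∈ PeriodicOperator.surface p}.ncard = 2 * n) ∧
    IsPathConnected (PeriodicOperator.unramifiedPart p) ∧
    IsConnected (PeriodicOperator.surface p) := by
  have h := PeriodicOperator.isPathConnected_unramifiedPart hn hp
  exact ⟨PeriodicOperator.not_accPt_discriminantSet hn hp,
    fun μ hμ => PeriodicOperator.ncard_fibre hμ, h,
    h.isConnected.subset_closure (fun w hw => hw.1)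
      (PeriodicOperator.surface_subset_closure hn hp)⟩
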